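/- **Setting.** For a finite simple graph $G=(V,E)$ let $\mathscr D_G$ be the set of families $D\subseteq E$ of edges no two of which have a vertex in common, and for $x>0$ let $$Z_G(x)=\sum_{D\in\mathscr D_G}x^{|V|-2|D|}$$ be the monomer-dimer partition function. For a vertex $v$ and $r\in\mathbb N$ let $[G,v]_r$ be the subgraph of $G$ induced by the vertices at graph distance at most $r$ from $v$, rooted at $v$; $\cong$ denotes isomorphism of rooted graphs. Let $P=(P_k)_{k\in\mathbb N}$ and $\rho=(\rho_k)_{k\in\mathbb N}$ be probability distributions on $\mathbb N=\{0,1,2,\dots\}$. The Galton-Watson tree $\mathcal T(P,\rho)$ is the random tree rooted at $o$ in which all numbers of children are independent, that of the root having law $P$ and that of every other node having law $\rho$; $\mathcal T(P,\rho,r)$ is its subtree induced by the generations $0,\dots,r$. It is unimodular if $\overline P:=\sum_k kP_k<\infty$ and $\overline P\,\rho_k=(k+1)P_{k+1}$ for all $k\in\mathbb N$ (that is, $\rho_k=(k+1)P_{k+1}/\overline P$ if $\overline P>0$; if $\overline P=0$ the tree is a single vertex and $\rho$ is not restricted by this condition). Let $G_n=(V_n,E_n)$, $n\in\mathbb N$,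 be random finite simple graphs defined on a common probability space such that: 1. $(G_n)$ converges locally to the unimodular Galton-Watson tree $\mathcal T(P,\rho)$: for every $r\in\mathbb N$ and every finite rooted tree $(T,o)$ with at most $r$ generations, $$\frac1{|V_n|}\sum_{v\in V_n}\mathbf 1\big(([G_n,v]_r,v)\cong(T,o)\big)\xrightarrow[n\to\infty]{}\mathbb P\big((\mathcal T(P,\rho,r),o)\cong(T,o)\big)\quad\text{a.s.};$$ 2. $P$ has finite second moment and $\overline\rho:=\sum_k k\rho_k<\infty$ (these two conditions are equivalent when $\overline P>0$); 3. $(G_n)$ is uniformly sparse: almost surely $$\lim_{l\to\infty}\limsup_{n\to\infty}\frac1{|V_n|}\sum_{v\in V_n}\deg_{G_n}(v)\,\mathbf 1\big(\deg_{G_n}(v)\ge l\big)=0 .$$ **Theorem.** For every $x>0$ there is exactly one probability distribution $\nu_x$ supported in $[0,1]$ that solves the distributional fixed-point equation $$X\overset{\mathcal D}{=}\frac{x^2}{x^2+\sum_{i=1}^K X_i},$$ where the $X_i$ are i.i.d. copies of $X$, $K$ has distribution $\rho$, and $K$ is independent of $(X_i)_i$. Almost surely, for every $x>0$, $$\frac{\log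 Z_{G_n}(x)}{|V_n|}\xrightarrow[n\to\infty]{}\mathbb E\Big[\log\Big(x+\sum_{i=1}^{\Delta}\frac{X_i}{x}\Big)\Big]-\frac{\overline P}{2}\,\mathbb E\Big[\log\Big(1+\frac{X_1}{x}\,\frac{X_2}{x}\Big)\Big],$$ where the $X_i$ are i.i.d. with law $\nu_x$, $\Delta$ has distribution $P$ and is independent of $(X_i)_i$, and both random variables under the expectations are integrable. -/

import Mathlib

open MeasureTheory Filter Topology
open scoped ENNReal

noncomputable section

namespace MonomerDimer

/-! ### The monomer-dimer model on a finite simple graph -/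

/-- A dimeric configuration on `G`: a set of edges of `G`, no two of which have a vertex
in common. -/
def IsDimerConfig {V : Type*} (G : SimpleGraph V) (D : Finset (Sym2 V)) : Prop :=
  (∀ e ∈ D, e ∈ G.edgeSet) ∧ ∀ e ∈ D, ∀ f ∈ D, e ≠ f → ∀ v : V, ¬ (v ∈ e ∧ v ∈ f)

open Classical in
/-- The partition function `Z_G(x) = ∑_D x ^ (|V| - 2 |D|)`, the sum being over all dimeric
configurations `D`. (The subtraction never truncates, since disjoint edges satisfy
`2 |D| ≤ |V|`.) -/
def partitionFunction {V : Type*} [Fintype V] (G : SimpleGraph V) (x : ℝ) : ℝ :=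
  ∑ D ∈ (Finset.univ : Finset (Finset (Sym2 V))).filter (fun D => IsDimerConfig G D),
    x ^ (Fintype.card V - 2 * D.card)

/-! ### Rooted graphs, balls and Galton-Watson trees -/

/-- Isomorphism of rooted graphs. -/
def RootedIso {V W : Type*} (G : SimpleGraph V) (o : V) (H : SimpleGraph W) (o' : W) : Prop :=
  ∃ e : G ≃g H, e o = o'

/-- The vertex set of the ball of centre `o` and radius `r` (the extended distance of vertices
in different components is infinite). -/
def ballSet {V : Type*} (G : SimpleGraph V) (o : V) (r : ℕ) : Set V :=
  {v | G.edist o v ≤ (r : ℕ∞)}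

lemma mem_ballSet_self {V : Type*} (G : SimpleGraph V) (o : V) (r : ℕ) :
    o ∈ ballSet G o r := by
  simp [ballSet]

/-- The ball `[G,o]_r`, rooted at `o`, is isomorphic to the rooted graph `(T,t)`. -/
def BallIso {V W : Type*} (G : SimpleGraph V) (o : V) (r : ℕ) (T : SimpleGraph W) (t : W) :
    Prop :=
  RootedIso (G.induce (ballSet G o r)) ⟨o, mem_ballSet_self G o r⟩ T t

/-- Given offspring numbers `K`, the nodes of the family tree in Ulam-Harris labelling: `[]` is
the root and `i :: u`, for `i < K u`, are the children of the node `u`. The length of a label is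
the generation of the node. -/
def IsNode (K : List ℕ → ℕ) : List ℕ → Prop
  | [] => True
  | i :: u => IsNode K u ∧ i < K u

/-- The family tree with offspring numbers `K`: each node is joined to its children. -/
def familyTree (K : List ℕ → ℕ) : SimpleGraph {u : List ℕ // IsNode K u} where
  Adj u v := (∃ i, u.1 = i :: v.1) ∨ (∃ i, v.1 = i :: u.1)
  symm := ⟨fun _ _ h => h.symm⟩
  loopless := ⟨fun u h => by
    rcases h with ⟨i, hi⟩ | ⟨i, hi⟩ <;> simpa using congrArg List.length hi⟩

/-- The nodes of the first `r` generations. -/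
def firstGenerations (K : List ℕ → ℕ) (r : ℕ) : Set {u : List ℕ // IsNode K u} :=
  {u | u.1.length ≤ r}

/-- The law of the offspring numbers of the Galton-Watson tree `𝒯(P,ρ)`: they are independent,
that of the root has law `P`, all the others have law `ρ`. -/
def offspringLaw (P ρ : PMF ℕ) : Measure (List ℕ → ℕ) :=
  Measure.infinitePi (fun u : List ℕ => (if u = [] then P else ρ).toMeasure)

/-- `ℙ((𝒯(P,ρ,r),o) ≅ (T,t))`, where `𝒯(P,ρ,r)` is the Galton-Watson tree `𝒯(P,ρ)` truncated
after the first `r` generations. -/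
def gwProb (P ρ : PMF ℕ) (r : ℕ) {W : Type*} (T : SimpleGraph W) (t : W) : ℝ :=
  (offspringLaw P ρ).real
    {K | RootedIso ((familyTree K).induce (firstGenerations K r))
      ⟨⟨[], trivial⟩, Nat.zero_le r⟩ T t}

/-- The mean of a distribution on `ℕ`. -/
def mean (P : PMF ℕ) : ℝ≥0∞ := ∑' k : ℕ, (k : ℝ≥0∞) * P k

/-- The second moment of a distribution on `ℕ`. -/
def secondMoment (P : PMF ℕ) : ℝ≥0∞ := ∑' k : ℕ, (k : ℝ≥0∞) ^ 2 * P k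

/-- The unimodularity condition: `P` has a finite mean `P̄` and `P̄ ρ_k = (k + 1) P_{k+1}` for
all `k`. For `P̄ > 0` this says `ρ_k = (k + 1) P_{k+1} / P̄`; for `P̄ = 0`, where the tree is
the isolated root and `ρ` plays no role in it, `ρ` is left free. -/
def IsUnimodular (P ρ : PMF ℕ) : Prop :=
  mean P ≠ ∞ ∧ ∀ k : ℕ, mean P * ρ k = ((k : ℝ≥0∞) + 1) * P (k + 1)

/-! ### Sequences of random graphs -/

section Sequences

variable {Ω : Type*} [MeasurableSpace Ω]

open Classical in
/-- The random graphs `G n` locally converge to the Galton-Watson tree `𝒯(P,ρ)`: for every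
radius `r` and every finite rooted tree `(T,t)` with at most `r` generations, almost surely the
fraction of the vertices `v` of `G n` with `([G n, v]_r, v) ≅ (T,t)` tends to
`ℙ((𝒯(P,ρ,r),o) ≅ (T,t))`. -/
def LocallyConverges (ℙ : Measure Ω) {V : ℕ → Ω → Type*} [∀ n ω, Fintype (V n ω)]
    (G : ∀ n ω, SimpleGraph (V n ω)) (P ρ : PMF ℕ) : Prop :=
  ∀ (r m : ℕ) (T : SimpleGraph (Fin m)) (t : Fin m), T.IsTree → (∀ v, T.dist t v ≤ r) →
    ∀ᵐ ω ∂ℙ, Tendsto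
      (fun n => (∑ v : V n ω, if BallIso (G n ω) v r T t then (1 : ℝ) else 0)
        / (Fintype.card (V n ω) : ℝ))
      atTop (𝓝 (gwProb P ρ r T t))

open Classical in
/-- `(1/|V|) ∑_v deg(v) 1(deg(v) ≥ l)`, with values in `[0,∞]`. -/
def highDegreeMass {V : Type*} [Fintype V] (G : SimpleGraph V) (l : ℕ) : ℝ≥0∞ :=
  (∑ v : V, if l ≤ G.degree v then (G.degree v : ℝ≥0∞) else 0) / (Fintype.card V : ℝ≥0∞)

/-- Uniform sparsity: almost surely
`lim_{l → ∞} limsup_{n → ∞} (1/|V_n|) ∑_v deg(v) 1(deg(v) ≥ l) = 0`. -/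
def UniformlySparse (ℙ : Measure Ω) {V : ℕ → Ω → Type*} [∀ n ω, Fintype (V n ω)]
    (G : ∀ n ω, SimpleGraph (V n ω)) : Prop :=
  ∀ᵐ ω ∂ℙ, Tendsto (fun l : ℕ => limsup (fun n => highDegreeMass (G n ω) l) atTop)
    atTop (𝓝 0)

end Sequences

/-! ### The fixed point equation and the limiting pressure -/

/-- The joint law of `(N, (X_i)_i)` where `N` has law `Q`, the `X_i` are i.i.d. of law `ν`, and
`N` and `(X_i)_i` are independent. -/
def jointLaw (Q : PMF ℕ) (ν : ProbabilityMeasure ℝ) : Measure (ℕ × (ℕ → ℝ)) :=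
  Q.toMeasure.prod (Measure.infinitePi (fun _ : ℕ => (ν : Measure ℝ)))

/-- The law `ν` is supported in `[0,1]` and solves the distributional equation
`X = x² / (x² + ∑_{i=1}^K X_i)` in law, where the `X_i` are i.i.d. copies of `X` independent of
`K`, and `K` has law `ρ`. -/
def IsFixedPoint (ρ : PMF ℕ) (x : ℝ) (ν : ProbabilityMeasure ℝ) : Prop :=
  (ν : Measure ℝ) (Set.Icc 0 1) = 1 ∧
    (jointLaw ρ ν).map (fun p => x ^ 2 / (x ^ 2 + ∑ i ∈ Finset.range p.1, p.2 i))
      = (ν : Measure ℝ)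

/-- The variable `log (x + ∑_{i=1}^Δ X_i / x)` as a function of `(Δ, (X_i)_i)`. -/
def vertexTerm (x : ℝ) (p : ℕ × (ℕ → ℝ)) : ℝ :=
  Real.log (x + ∑ i ∈ Finset.range p.1, p.2 i / x)

/-- The variable `log (1 + (X_1 / x) (X_2 / x))` as a function of `(Δ, (X_i)_i)`. -/
def edgeTerm (x : ℝ) (p : ℕ × (ℕ → ℝ)) : ℝ :=
  Real.log (1 + p.2 0 / x * (p.2 1 / x))

/-- `E[log (x + ∑_{i=1}^Δ X_i / x)] - (P̄ / 2) E[log (1 + (X_1 / x) (X_2 / x))]`. -/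
def limitPressure (P : PMF ℕ) (ν : ProbabilityMeasure ℝ) (x : ℝ) : ℝ :=
  (∫ p, vertexTerm x p ∂(jointLaw P ν))
    - (mean P).toReal / 2 * ∫ p, edgeTerm x p ∂(jointLaw P ν)

end MonomerDimer

end

noncomputable section

namespace MonomerDimer

/-! ### Splitting product measures -/

section Splitting

variable {S : Type*} [MeasurableSpace S]

lemma infinitePi_option_symm {α : Type*} (μ : Option α → Measure S)
    [∀ o, IsProbabilityMeasure (μ o)] :
    ((μ none).prod (Measure.infinitePi fun a => μ (some a))).map
      (fun p o => Option.elim o p.1 p.2) = Measure.infinitePi μ := by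
  have hm : Measurable (fun (p : S × (α → S)) (o : Option α) => Option.elim o p.1 p.2) := by
    refine measurable_pi_lambda _ fun o => ?_
    cases o
    · exact measurable_fst
    · exact (measurable_pi_apply _).comp measurable_snd
  refine Measure.eq_infinitePi _ fun s t ht => ?_
  rw [Measure.map_apply hm (.pi s.countable_toSet fun _ _ => ht _)]
  classical
  have hpi : ∀ s' : Finset α, (Measure.infinitePi fun a => μ (some a))
      (Set.pi s' fun a => t (some a)) = ∏ a ∈ s', μ (some a) (t (some a)) :=
    fun s' => Measure.infinitePi_pi _ fun a _ => ht _
  by_cases h : none ∈ s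
  · have e : (fun (p : S × (α → S)) (o : Option α) => Option.elim o p.1 p.2) ⁻¹'
        (Set.pi s t) = t none ×ˢ Set.pi s.eraseNone fun a => t (some a) := by
      ext p
      simp only [Set.mem_preimage, Set.mem_pi, Set.mem_prod, Finset.mem_coe,
        Finset.mem_eraseNone]
      exact ⟨fun H => ⟨H none h, fun a ha => H (some a) ha⟩,
        fun H o ho => by cases o; exacts [H.1, H.2 _ ho]⟩
    have e' : s = insert none (s.eraseNone.map Function.Embedding.some) := by
      ext o; cases o <;> simp [h]
    rw [e, Measure.prod_prod, hpi]
    conv_rhs => rw [e']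
    rw [Finset.prod_insert (by simp), Finset.prod_map]
    rfl
  · have e : (fun (p : S × (α → S)) (o : Option α) => Option.elim o p.1 p.2) ⁻¹'
        (Set.pi s t) = Set.univ ×ˢ Set.pi s.eraseNone fun a => t (some a) := by
      ext p
      simp only [Set.mem_preimage, Set.mem_pi, Set.mem_prod, Finset.mem_coe,
        Finset.mem_eraseNone]
      exact ⟨fun H => ⟨trivial, fun a ha => H (some a) ha⟩,
        fun H o ho => by cases o; exacts [absurd ho h, H.2 _ ho]⟩
    have e' : s = s.eraseNone.map Function.Embedding.some := by
      ext o; cases o <;> simp [h]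
    rw [e, Measure.prod_prod, hpi]
    conv_rhs => rw [e']
    rw [Finset.prod_map]
    simp

/-- In a product of probability measures, one coordinate and a family of other coordinates are
independent. -/
lemma infinitePi_map_split {ι α : Type*} (μ : ι → Measure S) [∀ i, IsProbabilityMeasure (μ i)]
    (a : ι) (f : α → ι) (hf : Function.Injective f) (ha : ∀ i, f i ≠ a) :
    (Measure.infinitePi μ).map (fun ω => (ω a, fun i => ω (f i)))
      = (μ a).prod (Measure.infinitePi fun i => μ (f i)) := by
  have hinj : Function.Injective (fun o : Option α => Option.elim o a f) := by
    rintro (_ | i) (_ | j) h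
    · rfl
    · exact absurd h.symm (ha j)
    · exact absurd h (ha i)
    · exact congrArg some (hf h)
  have h1 := Measure.map_infinitePi_infinitePi_of_inj (P := μ) hinj
  have h2 := infinitePi_option_symm (fun o : Option α => μ (Option.elim o a f))
  have hm : Measurable (fun (p : S × (α → S)) (o : Option α) => Option.elim o p.1 p.2) := by
    refine measurable_pi_lambda _ fun o => ?_
    cases o
    · exact measurable_fst
    · exact (measurable_pi_apply _).comp measurable_snd
  have hs : Measurable (fun ω : Option α → S => (ω none, fun i => ω (some i))) := by fun_prop
  have h3 := congrArg (Measure.map (fun ω : Option α → S => (ω none, fun i => ω (some i))))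
    (h1.trans h2.symm)
  rw [Measure.map_map hs (by fun_prop), Measure.map_map hs hm] at h3
  refine Eq.trans h3 ?_
  exact Measure.map_id

/-- The labelled subtree at the `i`-th child of the root. -/
def shift (i : ℕ) (L : List ℕ → S) : List ℕ → S := fun u => L (u ++ [i])

@[fun_prop]
lemma measurable_shift (i : ℕ) : Measurable (shift (S := S) i) :=
  measurable_pi_lambda _ fun _ => measurable_pi_apply _

lemma infinitePi_map_shift (κ : List ℕ → Measure S) [∀ u, IsProbabilityMeasure (κ u)] :
    (Measure.infinitePi κ).map (fun L => (L [], fun i => shift i L))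
      = (κ []).prod (Measure.infinitePi fun i => Measure.infinitePi fun u => κ (u ++ [i])) := by
  have hinj : Function.Injective (fun p : ℕ × List ℕ => p.2 ++ [p.1]) := by
    rintro ⟨i, u⟩ ⟨j, v⟩ h
    have := List.append_inj' h rfl
    simp only [List.cons.injEq, and_true] at this
    exact Prod.ext this.2 this.1
  have h1 := infinitePi_map_split κ [] (fun p : ℕ × List ℕ => p.2 ++ [p.1]) hinj (by simp)
  have h2 := Measure.infinitePi_map_curry (fun (i : ℕ) (u : List ℕ) => κ (u ++ [i]))
  have hc : Measurable (MeasurableEquiv.curry ℕ (List ℕ) S) := MeasurableEquiv.measurable _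
  have h3 := congrArg (Measure.map (Prod.map id (MeasurableEquiv.curry ℕ (List ℕ) S))) h1
  rw [Measure.map_map (by fun_prop) (by fun_prop), ← Measure.map_prod_map _ _ measurable_id hc,
    Measure.map_id, h2] at h3
  exact h3

lemma infinitePi_nat_map_split (μ : Measure S) [IsProbabilityMeasure μ] :
    (Measure.infinitePi fun _ : ℕ => μ).map (fun ω => (ω 0, fun i => ω (i + 1)))
      = μ.prod (Measure.infinitePi fun _ : ℕ => μ) :=
  infinitePi_map_split (fun _ : ℕ => μ) 0 (fun i => i + 1) (add_left_injective 1) (by simp)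

end Splitting

/-! ### Messages on trees -/

lemma measurable_sum_range {α M : Type*} [MeasurableSpace α] [MeasurableSpace M] [AddCommMonoid M]
    [MeasurableAdd₂ M] {N : α → ℕ} (hN : Measurable N) {g : ℕ → α → M}
    (hg : ∀ i, Measurable (g i)) : Measurable fun a => ∑ i ∈ Finset.range (N a), g i a := by
  have h : Measurable fun p : ℕ × α => ∑ i ∈ Finset.range p.1, g i p.2 :=
    measurable_from_prod_countable_right fun k =>
      Finset.measurable_sum (Finset.range k) fun i _ => hg i
  exact h.comp (hN.prodMk measurable_id)

/-- The message sent by the root of the first `r` generations of the family tree. -/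
def treeMsg {𝕜 : Type*} [Field 𝕜] (x : 𝕜) : ℕ → (List ℕ → ℕ) → 𝕜
  | 0, _ => 0
  | r + 1, K => (x + ∑ i ∈ Finset.range (K []), treeMsg x r (shift i K))⁻¹

/-- The size of the `r`-th generation of the family tree. -/
def genSize : ℕ → (List ℕ → ℕ) → ℕ
  | 0, _ => 1
  | r + 1, K => ∑ i ∈ Finset.range (K []), genSize r (shift i K)

@[fun_prop]
lemma measurable_genSize (r : ℕ) : Measurable (genSize r) := by
  induction r with
  | zero => exact measurable_const
  | succ r ih =>
    exact measurable_sum_range (measurable_pi_apply _) fun i => ih.comp (measurable_shift i)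

@[fun_prop]
lemma measurable_treeMsg (x : ℝ) (r : ℕ) : Measurable (treeMsg x r) := by
  induction r with
  | zero => exact measurable_const
  | succ r ih =>
    exact ((measurable_sum_range (measurable_pi_apply _)
      fun i => ih.comp (measurable_shift i)).const_add x).inv

section Real

variable {x : ℝ}

lemma treeMsg_nonneg (hx : 0 < x) (r : ℕ) (K : List ℕ → ℕ) : 0 ≤ treeMsg x r K := by
  induction r generalizing K with
  | zero => exact le_rfl
  | succ r ih =>
    exact inv_nonneg.2 (add_nonneg hx.le (Finset.sum_nonneg fun i _ => ih _))

lemma treeMsg_le (hx : 0 < x) (r : ℕ) (K : List ℕ → ℕ) : treeMsg x r K ≤ x⁻¹ := by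
  cases r with
  | zero => exact (inv_pos.2 hx).le
  | succ r =>
    exact inv_anti₀ hx (le_add_of_nonneg_right (Finset.sum_nonneg fun i _ => treeMsg_nonneg hx r _))

lemma treeMsg_succ_le_succ (hx : 0 < x) {r s : ℕ}
    (h : ∀ K, treeMsg x r K ≤ treeMsg x s K) (K : List ℕ → ℕ) :
    treeMsg x (s + 1) K ≤ treeMsg x (r + 1) K :=
  inv_anti₀ (add_pos_of_pos_of_nonneg hx (Finset.sum_nonneg fun i _ => treeMsg_nonneg hx r _))
    (by gcongr with i _; exact h _)

lemma treeMsg_even_mono (hx : 0 < x) (k : ℕ) (K : List ℕ → ℕ) :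
    treeMsg x (2 * k) K ≤ treeMsg x (2 * (k + 1)) K := by
  induction k generalizing K with
  | zero => exact treeMsg_nonneg hx _ _
  | succ k ih => exact treeMsg_succ_le_succ hx (treeMsg_succ_le_succ hx ih) K

lemma mul_treeMsg_le {y : ℝ} (hx : 0 < x) (hxy : x ≤ y) (r : ℕ) (K : List ℕ → ℕ) :
    x * treeMsg x r K ≤ y * treeMsg y r K ∧ x * treeMsg y r K ≤ y * treeMsg x r K := by
  have hy : 0 < y := hx.trans_le hxy
  induction r generalizing K with
  | zero => simp [treeMsg]
  | succ r ih =>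
    have hsx : 0 ≤ ∑ i ∈ Finset.range (K []), treeMsg x r (shift i K) :=
      Finset.sum_nonneg fun i _ => treeMsg_nonneg hx r _
    have hsy : 0 ≤ ∑ i ∈ Finset.range (K []), treeMsg y r (shift i K) :=
      Finset.sum_nonneg fun i _ => treeMsg_nonneg hy r _
    have h1 : x * ∑ i ∈ Finset.range (K []), treeMsg x r (shift i K)
        ≤ y * ∑ i ∈ Finset.range (K []), treeMsg y r (shift i K) := by
      rw [Finset.mul_sum, Finset.mul_sum]
      exact Finset.sum_le_sum fun i _ => (ih _).1
    have h2 : x * ∑ i ∈ Finset.range (K []), treeMsg y r (shift i K)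
        ≤ y * ∑ i ∈ Finset.range (K []), treeMsg x r (shift i K) := by
      rw [Finset.mul_sum, Finset.mul_sum]
      exact Finset.sum_le_sum fun i _ => (ih _).2
    simp only [treeMsg]
    constructor
    · rw [← div_eq_mul_inv, ← div_eq_mul_inv, div_le_div_iff₀ (by positivity) (by positivity)]
      nlinarith
    · rw [← div_eq_mul_inv, ← div_eq_mul_inv, div_le_div_iff₀ (by positivity) (by positivity)]
      nlinarith

end Real

section Complex

lemma treeMsg_ofReal (x : ℝ) (r : ℕ) (K : List ℕ → ℕ) :
    treeMsg (x : ℂ) r K = ((treeMsg x r K : ℝ) : ℂ) := by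
  induction r generalizing K with
  | zero => simp [treeMsg]
  | succ r ih => simp [treeMsg, ih]

variable {z : ℂ}

lemma treeMsg_re_nonneg (hz : 0 < z.re) (r : ℕ) (K : List ℕ → ℕ) : 0 ≤ (treeMsg z r K).re := by
  induction r generalizing K with
  | zero => simp [treeMsg]
  | succ r ih =>
    simp only [treeMsg, Complex.inv_re, Complex.add_re, Complex.re_sum]
    exact div_nonneg (add_nonneg hz.le (Finset.sum_nonneg fun i _ => ih _)) (Complex.normSq_nonneg _)

lemma re_le_re_add_sum_treeMsg (hz : 0 < z.re) (r : ℕ) (K : List ℕ → ℕ) :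
    z.re ≤ (z + ∑ i ∈ Finset.range (K []), treeMsg z r (shift i K)).re := by
  rw [Complex.add_re, Complex.re_sum]
  exact le_add_of_nonneg_right (Finset.sum_nonneg fun i _ => treeMsg_re_nonneg hz r _)

lemma add_sum_treeMsg_ne_zero (hz : 0 < z.re) (r : ℕ) (K : List ℕ → ℕ) :
    z + ∑ i ∈ Finset.range (K []), treeMsg z r (shift i K) ≠ 0 := fun h => by
  have := re_le_re_add_sum_treeMsg hz r K
  rw [h, Complex.zero_re] at this
  exact hz.not_ge this

lemma norm_treeMsg_le (hz : 0 < z.re) (r : ℕ) (K : List ℕ → ℕ) : ‖treeMsg z r K‖ ≤ z.re⁻¹ := by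
  cases r with
  | zero => simpa [treeMsg] using hz.le
  | succ r =>
    rw [treeMsg, norm_inv]
    exact inv_anti₀ hz ((re_le_re_add_sum_treeMsg hz r K).trans (Complex.re_le_norm _))

lemma differentiableOn_treeMsg (r : ℕ) (K : List ℕ → ℕ) :
    DifferentiableOn ℂ (fun z : ℂ => treeMsg z r K) {z : ℂ | 0 < z.re} := by
  induction r generalizing K with
  | zero => exact differentiableOn_const _
  | succ r ih =>
    exact (differentiableOn_id.add (DifferentiableOn.fun_sum fun i _ => ih _)).inv
      fun z hz => add_sum_treeMsg_ne_zero hz r K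

lemma norm_treeMsg_succ_sub_le {b : ℝ} (hb : 0 < b) (hz : b ≤ z.re) (r : ℕ) (K : List ℕ → ℕ) :
    ‖treeMsg z (r + 1) K - treeMsg z r K‖ ≤ b⁻¹ * ((b ^ 2)⁻¹ ^ r * genSize r K) := by
  have hz0 : 0 < z.re := hb.trans_le hz
  induction r generalizing K with
  | zero =>
    simpa [genSize, treeMsg] using (norm_treeMsg_le hz0 1 K).trans (inv_anti₀ hb hz)
  | succ r ih =>
    have hn : ∀ s, b ≤ ‖z + ∑ i ∈ Finset.range (K []), treeMsg z s (shift i K)‖ := fun s =>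
      hz.trans ((re_le_re_add_sum_treeMsg hz0 s K).trans (Complex.re_le_norm _))
    rw [treeMsg, treeMsg, inv_sub_inv (add_sum_treeMsg_ne_zero hz0 _ K)
      (add_sum_treeMsg_ne_zero hz0 _ K), norm_div, norm_mul, add_sub_add_left_eq_sub,
      ← Finset.sum_sub_distrib, genSize]
    have hnum : ‖∑ i ∈ Finset.range (K []), (treeMsg z r (shift i K) - treeMsg z (r + 1) (shift i K))‖
        ≤ ∑ i ∈ Finset.range (K []), b⁻¹ * ((b ^ 2)⁻¹ ^ r * genSize r (shift i K)) :=
      norm_sum_le_of_le _ fun i _ => by rw [norm_sub_rev]; exact ih _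
    have hden : b ^ 2 ≤ ‖z + ∑ i ∈ Finset.range (K []), treeMsg z (r + 1) (shift i K)‖
        * ‖z + ∑ i ∈ Finset.range (K []), treeMsg z r (shift i K)‖ := by
      rw [sq]; exact mul_le_mul (hn _) (hn _) hb.le (norm_nonneg _)
    refine (div_le_div₀ ((norm_nonneg _).trans hnum) hnum (by positivity) hden).trans (le_of_eq ?_)
    rw [Nat.cast_sum, ← Finset.mul_sum, ← Finset.mul_sum, pow_succ, div_eq_mul_inv]
    ring

end Complex

/-- A bounded sequence of holomorphic functions on a disc which tends to zero uniformly on a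
smaller concentric disc tends to zero on the whole disc. -/
lemma tendsto_zero_of_uniformly_small_disc {f : ℕ → ℂ → ℂ} {c : ℂ} {r R M : ℝ} {ε : ℕ → ℝ}
    (hr : 0 < r) (hrR : r < R) (hf : ∀ n, DifferentiableOn ℂ (f n) (Metric.ball c R))
    (hM : ∀ n, ∀ z ∈ Metric.ball c R, ‖f n z‖ ≤ M)
    (hε : ∀ n, ∀ z ∈ Metric.sphere c r, ‖f n z‖ ≤ ε n) (hε0 : Tendsto ε atTop (𝓝 0))
    {z : ℂ} (hz : z ∈ Metric.ball c R) : Tendsto (fun n => f n z) atTop (𝓝 0) := by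
  obtain ⟨s, hzs, hsR⟩ := exists_between (Metric.mem_ball.1 hz)
  have hs : 0 < s := dist_nonneg.trans_lt hzs
  have hcl : ∀ n t, t < R → DiffContOnCl ℂ (f n) (Metric.ball c t) := fun n t ht =>
    ((hf n).mono (Metric.closedBall_subset_ball ht)).diffContOnCl_ball (le_refl _)
  have hfac : ∀ k : ℕ, (0 : ℝ) < k.factorial := fun k => Nat.cast_pos.2 k.factorial_pos
  have hterm : ∀ n k, ∀ t C, 0 < t → t < R → (∀ w ∈ Metric.sphere c t, ‖f n w‖ ≤ C) →
      ‖((k.factorial : ℂ))⁻¹ • (z - c) ^ k • iteratedDeriv k (f n) c‖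
        ≤ C * (dist z c / t) ^ k := by
    intro n k t C ht htR hC
    have h := Complex.norm_iteratedDeriv_le_of_forall_mem_sphere_norm_le k ht (hcl n t htR) hC
    rw [norm_smul, norm_smul, norm_inv, norm_pow, Complex.norm_natCast, ← dist_eq_norm, div_pow]
    calc (k.factorial : ℝ)⁻¹ * (dist z c ^ k * ‖iteratedDeriv k (f n) c‖)
        ≤ (k.factorial : ℝ)⁻¹ * (dist z c ^ k * (k.factorial * C / t ^ k)) := by gcongr
      _ = C * (dist z c ^ k / t ^ k) := by field_simp [(hfac k).ne']
  have hsum : ∀ n, f n z = ∑' k : ℕ, ((k.factorial : ℂ))⁻¹ • (z - c) ^ k • iteratedDeriv k (f n) c :=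
    fun n => (Complex.taylorSeries_eq_on_ball (hf n) hz).symm
  simp_rw [hsum]
  have h0 : (0 : ℂ) = ∑' _ : ℕ, (0 : ℂ) := by simp
  rw [h0]
  refine tendsto_tsum_of_dominated_convergence (bound := fun k => M * (dist z c / s) ^ k) ?_ ?_ ?_
  · exact (summable_geometric_of_lt_one (by positivity) ((div_lt_one hs).2 hzs)).mul_left M
  · intro k
    refine squeeze_zero_norm (fun n => hterm n k r (ε n) hr hrR (hε n)) ?_
    simpa using hε0.mul_const _
  · exact Eventually.of_forall fun n k => hterm n k s M hs hsR fun w hw =>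
      hM n w (Metric.mem_ball.2 ((Metric.mem_sphere.1 hw).trans_lt hsR))

/-- If the generations grow at most exponentially, the messages from the first `r` generations
settle down at every temperature. -/
lemma tendsto_treeMsg_succ_sub {K : List ℕ → ℕ} {b : ℝ} (hb : 0 < b)
    (hK : Tendsto (fun r => (b ^ 2)⁻¹ ^ r * (genSize r K : ℝ)) atTop (𝓝 0)) {x : ℝ} (hx : 0 < x) :
    Tendsto (fun r => treeMsg x (r + 1) K - treeMsg x r K) atTop (𝓝 0) := by
  have hre : ∀ {t : ℝ} {w : ℂ}, dist w ((b + x : ℝ) + 1 : ℂ) ≤ t → b + x + 1 - t ≤ w.re := by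
    intro t w h
    have h1 := (Complex.abs_re_le_norm (w - ((b + x : ℝ) + 1 : ℂ))).trans
      ((dist_eq_norm w _).symm.le.trans h)
    have h2 := (abs_le.1 h1).1
    simp only [Complex.sub_re, Complex.add_re, Complex.ofReal_re, Complex.one_re] at h2
    linarith
  have key := tendsto_zero_of_uniformly_small_disc
    (f := fun r z => treeMsg z (r + 1) K - treeMsg z r K)
    (c := ((b + x : ℝ) + 1 : ℂ)) (r := 1 / 2) (R := b + 1 + x / 2) (M := (x / 2)⁻¹ + (x / 2)⁻¹)
    (ε := fun r => b⁻¹ * ((b ^ 2)⁻¹ ^ r * genSize r K)) (z := (x : ℂ))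
    (by norm_num) (by linarith) ?_ ?_ ?_ ?_ ?_
  · have h := (Complex.continuous_re.tendsto _).comp key
    simpa [Function.comp_def, treeMsg_ofReal] using h
  · intro r
    refine DifferentiableOn.mono ((differentiableOn_treeMsg (r + 1) K).sub
      (differentiableOn_treeMsg r K)) fun w hw => ?_
    have := hre (Metric.mem_ball.1 hw).le
    exact (by linarith : 0 < w.re)
  · intro r w hw
    have := hre (Metric.mem_ball.1 hw).le
    have hw2 : x / 2 ≤ w.re := by linarith
    have hw0 : 0 < w.re := by linarith
    exact (norm_sub_le _ _).trans (add_le_add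
      ((norm_treeMsg_le hw0 _ K).trans (inv_anti₀ (by linarith) hw2))
      ((norm_treeMsg_le hw0 _ K).trans (inv_anti₀ (by linarith) hw2)))
  · intro r w hw
    have := hre (Metric.mem_sphere.1 hw).le
    exact norm_treeMsg_succ_sub_le hb (by linarith) r K
  · simpa using hK.const_mul b⁻¹
  · rw [Metric.mem_ball, dist_eq_norm]
    have e : ((x : ℂ) - ((b + x : ℝ) + 1 : ℂ)) = ((-(b + 1) : ℝ) : ℂ) := by push_cast; ring
    rw [e, Complex.norm_real, Real.norm_eq_abs, abs_neg, abs_of_pos (by linarith)]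
    linarith

/-! ### Galton-Watson trees -/

instance (P ρ : PMF ℕ) : IsProbabilityMeasure (offspringLaw P ρ) := by
  unfold offspringLaw; infer_instance

instance (Q : PMF ℕ) (ν : ProbabilityMeasure ℝ) : IsProbabilityMeasure (jointLaw Q ν) := by
  unfold jointLaw; infer_instance

/-- The law of the number of children of the root and of i.i.d. labelled trees at the children. -/
def rootLaw {T : Type*} [MeasurableSpace T] (Q : PMF ℕ) (μ : Measure T) : Measure (ℕ × (ℕ → T)) :=
  Q.toMeasure.prod (Measure.infinitePi fun _ : ℕ => μ)

section RootLaw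

variable {T : Type*} [MeasurableSpace T] (Q : PMF ℕ) (μ : Measure T) [IsProbabilityMeasure μ]

instance : IsProbabilityMeasure (rootLaw Q μ) := by
  unfold rootLaw; infer_instance

lemma rootLaw_map {U : Type*} [MeasurableSpace U] {g : T → U} (hg : Measurable g) :
    (rootLaw Q μ).map (fun p => (p.1, fun i => g (p.2 i))) = rootLaw Q (μ.map g) := by
  have : IsProbabilityMeasure (μ.map g) := Measure.isProbabilityMeasure_map hg.aemeasurable
  have h := Measure.infinitePi_map_pi (fun _ : ℕ => μ) (fun _ => hg)
  rw [rootLaw, rootLaw, ← h]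
  have h2 := Measure.map_prod_map Q.toMeasure (Measure.infinitePi fun _ : ℕ => μ) measurable_id
    (show Measurable (fun (x : ℕ → T) (i : ℕ) => g (x i)) by fun_prop)
  rw [Measure.map_id] at h2
  exact h2.symm

lemma offspringLaw_map (P ρ : PMF ℕ) :
    (offspringLaw P ρ).map (fun K => (K [], fun i => shift i K))
      = rootLaw P (offspringLaw ρ ρ) := by
  have h := infinitePi_map_shift fun u : List ℕ => (if u = [] then P else ρ).toMeasure
  simpa [offspringLaw, rootLaw] using h

lemma measurable_root_shift :
    Measurable fun K : List ℕ → T => (K [], fun i => shift i K) := by fun_prop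

lemma map_eval_rootLaw (i : ℕ) : (rootLaw Q μ).map (fun p => p.2 i) = μ := by
  have h : (fun p : ℕ × (ℕ → T) => p.2 i) = (fun ω => ω i) ∘ Prod.snd := rfl
  rw [h, ← Measure.map_map (measurable_pi_apply i) measurable_snd, rootLaw,
    Measure.map_snd_prod, measure_univ, one_smul]
  exact Measure.infinitePi_map_eval _ i

lemma ae_rootLaw {p : T → Prop} (h : ∀ᵐ t ∂μ, p t) : ∀ᵐ q ∂rootLaw Q μ, ∀ i, p (q.2 i) := by
  rw [ae_all_iff]
  intro i
  have hi : ∀ᵐ t ∂(rootLaw Q μ).map (fun p => p.2 i), p t := by rwa [map_eval_rootLaw]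
  exact ae_of_ae_map (by fun_prop) hi

lemma ae_offspringLaw_shift {P ρ : PMF ℕ} {p : (List ℕ → ℕ) → Prop}
    (h : ∀ᵐ K ∂offspringLaw ρ ρ, p K) : ∀ᵐ K ∂offspringLaw P ρ, ∀ i, p (shift i K) := by
  have h1 := ae_rootLaw P (offspringLaw ρ ρ) h
  rw [← offspringLaw_map] at h1
  exact ae_of_ae_map measurable_root_shift.aemeasurable h1

lemma lintegral_rootLaw {f : ℕ × (ℕ → T) → ℝ≥0∞} (hf : Measurable f) :
    ∫⁻ p, f p ∂rootLaw Q μ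
      = ∑' k : ℕ, (∫⁻ ω, f (k, ω) ∂Measure.infinitePi fun _ : ℕ => μ) * Q k := by
  rw [rootLaw, lintegral_prod _ hf.aemeasurable, lintegral_countable']
  simp_rw [PMF.toMeasure_apply_singleton Q _ (MeasurableSet.singleton _)]

lemma lintegral_sum_rootLaw {g : T → ℝ≥0∞} (hg : Measurable g) :
    ∫⁻ p, ∑ i ∈ Finset.range p.1, g (p.2 i) ∂rootLaw Q μ = mean Q * ∫⁻ t, g t ∂μ := by
  rw [lintegral_rootLaw Q μ (measurable_sum_range measurable_fst fun i => by fun_prop), mean,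
    ← ENNReal.tsum_mul_right]
  refine tsum_congr fun k => ?_
  rw [lintegral_finsetSum (Finset.range k) fun i _ => by fun_prop]
  have h : ∀ i : ℕ, ∫⁻ ω, g (ω i) ∂(Measure.infinitePi fun _ : ℕ => μ) = ∫⁻ t, g t ∂μ := by
    intro i
    rw [← lintegral_map (f := g) hg (measurable_pi_apply i),
      Measure.infinitePi_map_eval (fun _ : ℕ => μ) i]
  simp_rw [h]
  simp only [Finset.sum_const, Finset.card_range, nsmul_eq_mul]
  ring

end RootLaw

@[fun_prop]
lemma measurable_natCast_genSize (r : ℕ) : Measurable fun K => (genSize r K : ℝ≥0∞) :=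
  (measurable_from_top (f := fun n : ℕ => (n : ℝ≥0∞))).comp (measurable_genSize r)

lemma lintegral_genSize (ρ : PMF ℕ) (r : ℕ) :
    ∫⁻ K, (genSize r K : ℝ≥0∞) ∂offspringLaw ρ ρ = mean ρ ^ r := by
  induction r with
  | zero => simp [genSize]
  | succ r ih =>
    have h := lintegral_sum_rootLaw ρ (offspringLaw ρ ρ) (measurable_natCast_genSize r)
    rw [← offspringLaw_map, lintegral_map (measurable_sum_range measurable_fst fun i => by fun_prop)
      measurable_root_shift, ih] at h
    rw [pow_succ', ← h]
    simp [genSize]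

/-- The messages from the first `r` generations settle down as `r → ∞`. -/
def Settles (K : List ℕ → ℕ) : Prop :=
  ∀ x : ℝ, 0 < x → Tendsto (fun r => treeMsg x (r + 1) K - treeMsg x r K) atTop (𝓝 0)

lemma ae_settles {ρ : PMF ℕ} (hρ : mean ρ ≠ ∞) : ∀ᵐ K ∂offspringLaw ρ ρ, Settles K := by
  set b : ℝ := (mean ρ).toReal + 1 with hb
  have hb0 : 0 < b := by positivity
  have hm : ∀ r, Measurable fun K => ENNReal.ofReal ((b ^ 2)⁻¹ ^ r) * (genSize r K : ℝ≥0∞) :=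
    fun r => (measurable_natCast_genSize r).const_mul _
  have hfin : ∫⁻ K, ∑' r, ENNReal.ofReal ((b ^ 2)⁻¹ ^ r) * (genSize r K : ℝ≥0∞)
      ∂offspringLaw ρ ρ ≠ ∞ := by
    rw [lintegral_tsum fun r => (hm r).aemeasurable]
    have h : ∀ r, ∫⁻ K, ENNReal.ofReal ((b ^ 2)⁻¹ ^ r) * (genSize r K : ℝ≥0∞) ∂offspringLaw ρ ρ
        = ENNReal.ofReal ((b ^ 2)⁻¹ * (mean ρ).toReal) ^ r := by
      intro r
      rw [lintegral_const_mul _ (measurable_natCast_genSize r), lintegral_genSize, ENNReal.ofReal_mul (by positivity),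
        ENNReal.ofReal_toReal hρ, mul_pow, ENNReal.ofReal_pow (by positivity)]
    simp_rw [h]
    have hlt : ENNReal.ofReal ((b ^ 2)⁻¹ * (mean ρ).toReal) < 1 := by
      rw [ENNReal.ofReal_lt_one, inv_mul_lt_one₀ (by positivity), hb]
      nlinarith [ENNReal.toReal_nonneg (a := mean ρ)]
    rw [ENNReal.tsum_geometric]
    exact ENNReal.inv_ne_top.2 (tsub_pos_of_lt hlt).ne'
  filter_upwards [ae_lt_top (Measurable.tsum hm) hfin] with K hK x hx
  refine tendsto_treeMsg_succ_sub hb0 ?_ hx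
  have h := (ENNReal.tendsto_toReal ENNReal.zero_ne_top).comp
    (ENNReal.tendsto_atTop_zero_of_tsum_ne_top hK.ne)
  refine (h.congr fun r => ?_)
  simp only [Function.comp_apply, ENNReal.toReal_mul, ENNReal.toReal_natCast]
  rw [ENNReal.toReal_ofReal (by positivity)]

/-- The message sent by the root of the family tree. -/
def treeLim (x : ℝ) (K : List ℕ → ℕ) : ℝ := ⨆ k : ℕ, treeMsg x (2 * k) K

section TreeLim

variable {x : ℝ}

@[fun_prop]
lemma measurable_treeLim (x : ℝ) : Measurable (treeLim x) :=
  Measurable.iSup fun k => measurable_treeMsg x (2 * k)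

lemma bddAbove_treeMsg (hx : 0 < x) (K : List ℕ → ℕ) :
    BddAbove (Set.range fun k : ℕ => treeMsg x (2 * k) K) :=
  ⟨x⁻¹, by rintro _ ⟨k, rfl⟩; exact treeMsg_le hx _ K⟩

lemma treeLim_nonneg (hx : 0 < x) (K : List ℕ → ℕ) : 0 ≤ treeLim x K :=
  Real.iSup_nonneg fun _ => treeMsg_nonneg hx _ K

lemma treeLim_le (hx : 0 < x) (K : List ℕ → ℕ) : treeLim x K ≤ x⁻¹ :=
  ciSup_le fun _ => treeMsg_le hx _ K

lemma Settles.tendsto {K : List ℕ → ℕ} (hK : Settles K) (hx : 0 < x) :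
    Tendsto (fun r => treeMsg x r K) atTop (𝓝 (treeLim x K)) := by
  have h1 : Tendsto (fun k : ℕ => treeMsg x (2 * k) K) atTop (𝓝 (treeLim x K)) :=
    tendsto_atTop_ciSup (monotone_nat_of_le_succ fun k => treeMsg_even_mono hx k K)
      (bddAbove_treeMsg hx K)
  have hdiv : Tendsto (fun n : ℕ => n / 2) atTop atTop := Nat.tendsto_div_const_atTop two_ne_zero
  have h2 : Tendsto (fun n : ℕ => 2 * (n / 2)) atTop atTop :=
    hdiv.const_mul_atTop' two_pos
  have h3 : Tendsto (fun n => treeMsg x n K - treeMsg x (2 * (n / 2)) K) atTop (𝓝 0) := by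
    have h4 := ((hK x hx).comp h2).norm
    rw [norm_zero] at h4
    refine squeeze_zero_norm (fun n => ?_) h4
    rcases Nat.even_or_odd' n with ⟨k, rfl | rfl⟩
    · simp
    · have : (2 * k + 1) / 2 = k := by omega
      simp [this]
  simpa using (h1.comp hdiv).add h3

lemma tendsto_treeMsg_of_settles_shift {K : List ℕ → ℕ} (hK : ∀ i, Settles (shift i K))
    (hx : 0 < x) :
    Tendsto (fun r => treeMsg x r K) atTop
      (𝓝 (x + ∑ i ∈ Finset.range (K []), treeLim x (shift i K))⁻¹) := by
  rw [← tendsto_add_atTop_iff_nat 1]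
  have h0 : x + ∑ i ∈ Finset.range (K []), treeLim x (shift i K) ≠ 0 :=
    (add_pos_of_pos_of_nonneg hx (Finset.sum_nonneg fun i _ => treeLim_nonneg hx _)).ne'
  exact ((tendsto_finsetSum _ fun i _ => (hK i).tendsto hx).const_add x).inv₀ h0

lemma treeLim_eq {K : List ℕ → ℕ} (h : Settles K) (hK : ∀ i, Settles (shift i K)) (hx : 0 < x) :
    treeLim x K = (x + ∑ i ∈ Finset.range (K []), treeLim x (shift i K))⁻¹ :=
  tendsto_nhds_unique (h.tendsto hx) (tendsto_treeMsg_of_settles_shift hK hx)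

lemma Settles.mul_treeLim_le {K : List ℕ → ℕ} (hK : Settles K) {y : ℝ} (hx : 0 < x)
    (hxy : x ≤ y) :
    x * treeLim x K ≤ y * treeLim y K ∧ x * treeLim y K ≤ y * treeLim x K := by
  have h1 := hK.tendsto hx
  have h2 := hK.tendsto (hx.trans_le hxy)
  exact ⟨le_of_tendsto_of_tendsto' (h1.const_mul x) (h2.const_mul y)
      fun r => (mul_treeMsg_le hx hxy r K).1,
    le_of_tendsto_of_tendsto' (h2.const_mul x) (h1.const_mul y)
      fun r => (mul_treeMsg_le hx hxy r K).2⟩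

end TreeLim

/-- The message sent by a root with given children. -/
def rootMsg (x : ℝ) (p : ℕ × (ℕ → List ℕ → ℕ)) : ℝ :=
  (x + ∑ i ∈ Finset.range p.1, treeLim x (p.2 i))⁻¹

@[fun_prop]
lemma measurable_rootMsg (x : ℝ) : Measurable (rootMsg x) :=
  ((measurable_sum_range measurable_fst
    fun i => (measurable_treeLim x).comp (by fun_prop)).const_add x).inv

lemma map_treeLim {ρ : PMF ℕ} (hρ : mean ρ ≠ ∞) {x : ℝ} (hx : 0 < x) :
    (rootLaw ρ (offspringLaw ρ ρ)).map (rootMsg x) = (offspringLaw ρ ρ).map (treeLim x) := by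
  rw [← offspringLaw_map, Measure.map_map (measurable_rootMsg x) measurable_root_shift]
  refine Measure.map_congr ?_
  filter_upwards [ae_settles hρ, ae_offspringLaw_shift (ae_settles hρ)] with K h1 h2
  exact (treeLim_eq h1 h2 hx).symm

/-! ### The fixed point equation -/

/-- The law of `x m`, where `m` is the message sent by the root of the Galton-Watson tree. -/
def limitLaw (ρ : PMF ℕ) (x : ℝ) : ProbabilityMeasure ℝ :=
  ⟨(offspringLaw ρ ρ).map fun K => x * treeLim x K,
    Measure.isProbabilityMeasure_map ((measurable_treeLim x).const_mul x).aemeasurable⟩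

lemma jointLaw_eq_rootLaw (Q : PMF ℕ) (ν : ProbabilityMeasure ℝ) :
    jointLaw Q ν = rootLaw Q (ν : Measure ℝ) := rfl

lemma jointLaw_limitLaw (Q ρ : PMF ℕ) (x : ℝ) :
    jointLaw Q (limitLaw ρ x)
      = (rootLaw Q (offspringLaw ρ ρ)).map (fun p => (p.1, fun i => x * treeLim x (p.2 i))) :=
  (rootLaw_map Q _ ((measurable_treeLim x).const_mul x)).symm

lemma measurable_fixedPointMap (x : ℝ) : Measurable fun p : ℕ × (ℕ → ℝ) =>
    x ^ 2 / (x ^ 2 + ∑ i ∈ Finset.range p.1, p.2 i) :=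
  (measurable_const.div ((measurable_sum_range measurable_fst fun i => by fun_prop).const_add _))

lemma sq_div_sq_add_sum {x : ℝ} (hx : 0 < x) (k : ℕ) (f : ℕ → ℝ) :
    x ^ 2 / (x ^ 2 + ∑ i ∈ Finset.range k, x * f i)
      = x * (x + ∑ i ∈ Finset.range k, f i)⁻¹ := by
  rw [← Finset.mul_sum, sq, ← mul_add, mul_div_mul_left _ _ hx.ne', div_eq_mul_inv]

lemma isFixedPoint_limitLaw {ρ : PMF ℕ} (hρ : mean ρ ≠ ∞) {x : ℝ} (hx : 0 < x) :
    IsFixedPoint ρ x (limitLaw ρ x) := by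
  have hm : Measurable fun K => x * treeLim x K := (measurable_treeLim x).const_mul x
  constructor
  · refine (Measure.map_apply hm measurableSet_Icc).trans ?_
    have : (fun K => x * treeLim x K) ⁻¹' Set.Icc 0 1 = Set.univ := by
      refine Set.eq_univ_of_forall fun K => ⟨mul_nonneg hx.le (treeLim_nonneg hx K), ?_⟩
      exact (mul_le_mul_of_nonneg_left (treeLim_le hx K) hx.le).trans_eq (mul_inv_cancel₀ hx.ne')
    rw [this, measure_univ]
  · rw [jointLaw_limitLaw, Measure.map_map (measurable_fixedPointMap x) (by fun_prop)]
    have e : (fun p : ℕ × (ℕ → ℝ) => x ^ 2 / (x ^ 2 + ∑ i ∈ Finset.range p.1, p.2 i)) ∘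
        (fun p : ℕ × (ℕ → List ℕ → ℕ) => (p.1, fun i => x * treeLim x (p.2 i)))
        = (fun t => x * t) ∘ rootMsg x := by
      funext p
      exact sq_div_sq_add_sum hx _ _
    rw [e, ← Measure.map_map (measurable_const_mul x) (measurable_rootMsg x), map_treeLim hρ hx,
      Measure.map_map (measurable_const_mul x) (measurable_treeLim x)]
    rfl

/-- The message sent by the root of the first `r` generations, when the nodes of generation `r`
send the messages prescribed by their labels. -/
def boundaryMsg (x : ℝ) : ℕ → (List ℕ → ℕ × ℝ) → ℝ
  | 0, L => x⁻¹ * (L []).2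
  | r + 1, L => (x + ∑ i ∈ Finset.range (L []).1, boundaryMsg x r (shift i L))⁻¹

@[fun_prop]
lemma measurable_boundaryMsg (x : ℝ) (r : ℕ) : Measurable (boundaryMsg x r) := by
  induction r with
  | zero => exact (measurable_snd.comp (measurable_pi_apply _)).const_mul _
  | succ r ih =>
    exact ((measurable_sum_range (measurable_fst.comp (measurable_pi_apply _))
      fun i => ih.comp (measurable_shift i)).const_add x).inv

lemma boundaryMsg_bounds {x : ℝ} (hx : 0 < x) (r : ℕ) (L : List ℕ → ℕ × ℝ)
    (hL : ∀ u, (L u).2 ∈ Set.Icc (0 : ℝ) 1) :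
    treeMsg x (2 * r) (fun u => (L u).1) ≤ boundaryMsg x (2 * r) L ∧
      boundaryMsg x (2 * r) L ≤ treeMsg x (2 * r + 1) (fun u => (L u).1) := by
  have pos : ∀ s (N : ℕ) (f : ℕ → List ℕ → ℕ),
      0 < x + ∑ i ∈ Finset.range N, treeMsg x s (f i) := fun s N f =>
    add_pos_of_pos_of_nonneg hx (Finset.sum_nonneg fun i _ => treeMsg_nonneg hx s _)
  induction r generalizing L with
  | zero =>
    refine ⟨mul_nonneg (inv_pos.2 hx).le (hL _).1, ?_⟩
    simpa [treeMsg, boundaryMsg] using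
      mul_le_of_le_one_right (inv_pos.2 hx).le (hL []).2
  | succ r ih =>
    have step : ∀ L : List ℕ → ℕ × ℝ, (∀ u, (L u).2 ∈ Set.Icc (0 : ℝ) 1) →
        treeMsg x (2 * r + 2) (fun u => (L u).1) ≤ boundaryMsg x (2 * r + 1) L ∧
        boundaryMsg x (2 * r + 1) L ≤ treeMsg x (2 * r + 1) (fun u => (L u).1) := by
      intro L hL
      have hb : 0 < x + ∑ i ∈ Finset.range (L []).1, boundaryMsg x (2 * r) (shift i L) :=
        add_pos_of_pos_of_nonneg hx (Finset.sum_nonneg fun i _ =>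
          (treeMsg_nonneg hx _ _).trans (ih (shift i L) fun u => hL _).1)
      exact ⟨inv_anti₀ hb (by gcongr with i _; exact (ih (shift i L) fun u => hL _).2),
        inv_anti₀ (pos _ _ _) (by gcongr with i _; exact (ih (shift i L) fun u => hL _).1)⟩
    have hb : 0 < x + ∑ i ∈ Finset.range (L []).1, boundaryMsg x (2 * r + 1) (shift i L) :=
      add_pos_of_pos_of_nonneg hx (Finset.sum_nonneg fun i _ =>
        (treeMsg_nonneg hx _ _).trans (step (shift i L) fun u => hL _).1)
    exact ⟨inv_anti₀ hb (by gcongr with i _; exact (step (shift i L) fun u => hL _).2),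
      inv_anti₀ (pos _ _ _) (by gcongr with i _; exact (step (shift i L) fun u => hL _).1)⟩

/-- The law of a Galton-Watson tree with independent labels of law `ν`. -/
def labelledLaw (ρ : PMF ℕ) (ν : ProbabilityMeasure ℝ) : Measure (List ℕ → ℕ × ℝ) :=
  Measure.infinitePi fun _ => ρ.toMeasure.prod (ν : Measure ℝ)

instance (ρ : PMF ℕ) (ν : ProbabilityMeasure ℝ) : IsProbabilityMeasure (labelledLaw ρ ν) := by
  unfold labelledLaw; infer_instance

lemma map_fst_labelledLaw (ρ : PMF ℕ) (ν : ProbabilityMeasure ℝ) :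
    (labelledLaw ρ ν).map (fun L u => (L u).1) = offspringLaw ρ ρ := by
  have h := Measure.infinitePi_map_pi (fun _ : List ℕ => ρ.toMeasure.prod (ν : Measure ℝ))
    (f := fun _ => Prod.fst) fun _ => measurable_fst
  simpa [offspringLaw, labelledLaw] using h

lemma ae_labelledLaw (ρ : PMF ℕ) {ν : ProbabilityMeasure ℝ} {s : Set ℝ} (hs : MeasurableSet s)
    (h : (ν : Measure ℝ) s = 1) : ∀ᵐ L ∂labelledLaw ρ ν, ∀ u, (L u).2 ∈ s := by
  rw [ae_all_iff]
  intro u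
  have h1 : ∀ᵐ t ∂(ν : Measure ℝ), t ∈ s := (prob_compl_eq_zero_iff hs).2 h
  have h2 : (labelledLaw ρ ν).map (fun L => (L u).2) = (ν : Measure ℝ) := by
    have e : (fun L : List ℕ → ℕ × ℝ => (L u).2) = Prod.snd ∘ (fun L => L u) := rfl
    rw [e, ← Measure.map_map measurable_snd (measurable_pi_apply u), labelledLaw,
      Measure.infinitePi_map_eval, Measure.map_snd_prod, measure_univ, one_smul]
  rw [← h2] at h1
  have hm : Measurable fun L : List ℕ → ℕ × ℝ => (L u).2 := by fun_prop
  exact ae_of_ae_map hm.aemeasurable h1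

lemma map_boundaryMsg {ρ : PMF ℕ} {x : ℝ} (hx : 0 < x) {ν : ProbabilityMeasure ℝ}
    (hν : IsFixedPoint ρ x ν) (r : ℕ) :
    (labelledLaw ρ ν).map (fun L => x * boundaryMsg x r L) = (ν : Measure ℝ) := by
  induction r with
  | zero =>
    have e : (fun L : List ℕ → ℕ × ℝ => x * boundaryMsg x 0 L) = Prod.snd ∘ (fun L => L []) := by
      funext L
      simp [boundaryMsg, mul_inv_cancel_left₀ hx.ne']
    rw [e, ← Measure.map_map measurable_snd (measurable_pi_apply _), labelledLaw,
      Measure.infinitePi_map_eval, Measure.map_snd_prod, measure_univ, one_smul]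
  | succ r ih =>
    have hm : Measurable fun L => x * boundaryMsg x r L := (measurable_boundaryMsg x r).const_mul x
    have h1 : (labelledLaw ρ ν).map (fun L => ((L []).1, fun i => shift i L))
        = rootLaw ρ (labelledLaw ρ ν) := by
      have h := congrArg (Measure.map (Prod.map Prod.fst id))
        (infinitePi_map_shift fun _ : List ℕ => ρ.toMeasure.prod (ν : Measure ℝ))
      rw [Measure.map_map (by fun_prop) (by fun_prop),
        ← Measure.map_prod_map _ _ measurable_fst measurable_id, Measure.map_id,
        Measure.map_fst_prod, measure_univ, one_smul] at h
      exact h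
    have h2 := rootLaw_map ρ (labelledLaw ρ ν) hm
    rw [ih, ← jointLaw_eq_rootLaw, ← h1, Measure.map_map (by fun_prop) (by fun_prop)] at h2
    have h3 := hν.2
    rw [← h2, Measure.map_map (measurable_fixedPointMap x) (by fun_prop)] at h3
    refine Eq.trans ?_ h3
    congr 1
    funext L
    exact (sq_div_sq_add_sum hx _ _).symm

lemma IsFixedPoint.eq_limitLaw {ρ : PMF ℕ} (hρ : mean ρ ≠ ∞) {x : ℝ} (hx : 0 < x)
    {ν : ProbabilityMeasure ℝ} (hν : IsFixedPoint ρ x ν) : ν = limitLaw ρ x := by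
  refine Subtype.ext (ext_of_forall_integral_eq_of_IsFiniteMeasure (μ := (ν : Measure ℝ))
    (ν := (limitLaw ρ x : Measure ℝ)) fun f => ?_)
  have hbm : ∀ r, Measurable fun L => x * boundaryMsg x r L :=
    fun r => (measurable_boundaryMsg x r).const_mul x
  have hlm : Measurable fun K => x * treeLim x K := (measurable_treeLim x).const_mul x
  have hfst : Measurable fun (L : List ℕ → ℕ × ℝ) u => (L u).1 := by fun_prop
  have h1 : ∀ r : ℕ, ∫ t, f t ∂(ν : Measure ℝ)
      = ∫ L, f (x * boundaryMsg x (2 * r) L) ∂labelledLaw ρ ν := by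
    intro r
    conv_lhs => rw [← map_boundaryMsg hx hν (2 * r)]
    exact integral_map (hbm _).aemeasurable f.continuous.aestronglyMeasurable
  have h2 : ∫ t, f t ∂(limitLaw ρ x : Measure ℝ)
      = ∫ L, f (x * treeLim x fun u => (L u).1) ∂labelledLaw ρ ν := by
    have e : (limitLaw ρ x : Measure ℝ)
        = (labelledLaw ρ ν).map (fun L => x * treeLim x fun u => (L u).1) := by
      have h := Measure.map_map (μ := labelledLaw ρ ν) hlm hfst
      rw [map_fst_labelledLaw] at h
      exact h
    rw [e]
    exact integral_map (hlm.comp hfst).aemeasurable f.continuous.aestronglyMeasurable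
  have hset : ∀ᵐ L ∂labelledLaw ρ ν, Settles fun u => (L u).1 := by
    have h := ae_settles hρ
    rw [← map_fst_labelledLaw ρ ν] at h
    exact ae_of_ae_map hfst.aemeasurable h
  have h3 : Tendsto (fun r : ℕ => ∫ L, f (x * boundaryMsg x (2 * r) L) ∂labelledLaw ρ ν) atTop
      (𝓝 (∫ L, f (x * treeLim x fun u => (L u).1) ∂labelledLaw ρ ν)) := by
    refine tendsto_integral_of_dominated_convergence (fun _ => ‖f‖)
      (fun r => (f.continuous.measurable.comp (hbm _)).aestronglyMeasurable)
      (integrable_const _) (fun r => Eventually.of_forall fun L => f.norm_coe_le_norm _) ?_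
    filter_upwards [hset, ae_labelledLaw ρ measurableSet_Icc hν.1] with L hL hI
    refine (f.continuous.tendsto _).comp (Tendsto.const_mul x ?_)
    have ht := hL.tendsto hx
    have hev : Tendsto (fun r : ℕ => 2 * r) atTop atTop := tendsto_id.const_mul_atTop' two_pos
    exact tendsto_of_tendsto_of_tendsto_of_le_of_le (ht.comp hev)
      (ht.comp ((tendsto_add_atTop_nat 1).comp hev))
      (fun r => (boundaryMsg_bounds hx r L hI).1) (fun r => (boundaryMsg_bounds hx r L hI).2)
  rw [h2]
  refine tendsto_nhds_unique ?_ h3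
  simp_rw [← h1]
  exact tendsto_const_nhds

theorem existsUnique_isFixedPoint {ρ : PMF ℕ} (hρ : mean ρ ≠ ∞) {x : ℝ} (hx : 0 < x) :
    ∃! ν : ProbabilityMeasure ℝ, IsFixedPoint ρ x ν :=
  ⟨limitLaw ρ x, isFixedPoint_limitLaw hρ hx, fun _ hν => hν.eq_limitLaw hρ hx⟩

/-! ### The limiting pressure -/

section RootIntegrals

variable {T : Type*} [MeasurableSpace T] {Q : PMF ℕ} (μ : Measure T) [IsProbabilityMeasure μ]

lemma integrable_fst_rootLaw (hQ : mean Q ≠ ∞) :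
    Integrable (fun p : ℕ × (ℕ → T) => (p.1 : ℝ)) (rootLaw Q μ) := by
  have hm : Measurable fun p : ℕ × (ℕ → T) => (p.1 : ℝ) :=
    (measurable_from_top (f := fun n : ℕ => (n : ℝ))).comp measurable_fst
  refine ⟨hm.aestronglyMeasurable, ?_⟩
  rw [hasFiniteIntegral_iff_enorm, lintegral_rootLaw Q μ hm.enorm]
  simpa [mean] using hQ.lt_top

lemma integrable_fst_sq_rootLaw (hQ : secondMoment Q ≠ ∞) :
    Integrable (fun p : ℕ × (ℕ → T) => (p.1 : ℝ) ^ 2) (rootLaw Q μ) := by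
  have hm : Measurable fun p : ℕ × (ℕ → T) => (p.1 : ℝ) ^ 2 :=
    (measurable_from_top (f := fun n : ℕ => (n : ℝ) ^ 2)).comp measurable_fst
  refine ⟨hm.aestronglyMeasurable, ?_⟩
  rw [hasFiniteIntegral_iff_enorm, lintegral_rootLaw Q μ hm.enorm]
  simpa [secondMoment] using hQ.lt_top

lemma integral_fst_rootLaw :
    ∫ p : ℕ × (ℕ → T), (p.1 : ℝ) ∂rootLaw Q μ = (mean Q).toReal := by
  have hm : Measurable fun p : ℕ × (ℕ → T) => (p.1 : ℝ) :=
    (measurable_from_top (f := fun n : ℕ => (n : ℝ))).comp measurable_fst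
  rw [integral_eq_lintegral_of_nonneg_ae (f := fun p : ℕ × (ℕ → T) => (p.1 : ℝ))
    (Eventually.of_forall fun p => Nat.cast_nonneg p.1) hm.aestronglyMeasurable, lintegral_rootLaw Q μ hm.ennreal_ofReal]
  simp [mean]

lemma integral_rootLaw {f : ℕ × (ℕ → T) → ℝ} (hf : Integrable f (rootLaw Q μ)) :
    ∫ p, f p ∂rootLaw Q μ
      = ∑' k : ℕ, (Q k).toReal * ∫ ω, f (k, ω) ∂Measure.infinitePi fun _ : ℕ => μ := by
  rw [rootLaw] at hf ⊢
  rw [integral_prod _ hf, PMF.integral_eq_tsum _ _ hf.integral_prod_left]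
  rfl

lemma integral_infinitePi_swap {g : T → ℝ → ℝ} {m : T → ℝ} (hg : Measurable (Function.uncurry g))
    (hm : Measurable m) {i k : ℕ} (hi : i < k) :
    ∫ ω, g (ω i) (∑ j ∈ Finset.range k, m (ω j)) ∂(Measure.infinitePi fun _ : ℕ => μ)
      = ∫ ω, g (ω 0) (∑ j ∈ Finset.range k, m (ω j)) ∂(Measure.infinitePi fun _ : ℕ => μ) := by
  have h := Measure.map_infinitePi_infinitePi_of_inj (P := fun _ : ℕ => μ)
    (Equiv.swap 0 i).injective
  have hG : Measurable fun ω : ℕ → T => g (ω 0) (∑ j ∈ Finset.range k, m (ω j)) :=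
    hg.comp ((measurable_pi_apply 0).prodMk
      (Finset.measurable_sum (Finset.range k) fun j _ => hm.comp (measurable_pi_apply j)))
  conv_rhs => rw [← h]
  rw [integral_map (measurable_pi_lambda _ fun _ => measurable_pi_apply _).aemeasurable hG.aestronglyMeasurable]
  refine integral_congr_ae (Eventually.of_forall fun ω => ?_)
  simp only [Equiv.swap_apply_left]
  congr 1
  refine (Finset.sum_equiv (Equiv.swap 0 i) (fun j => ?_) fun j _ => rfl).symm
  simp only [Finset.mem_range]
  rcases eq_or_ne j 0 with rfl | h0
  · simpa using ⟨fun _ => hi, fun _ => by omega⟩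
  rcases eq_or_ne j i with rfl | h1
  · simpa using ⟨fun _ => by omega, fun _ => hi⟩
  · rw [Equiv.swap_apply_of_ne_of_ne h0 h1]

/-- The mass transport identity of a unimodular Galton-Watson tree, for the messages. -/
lemma integral_sum_div_of_isUnimodular {P ρ : PMF ℕ} (hPρ : IsUnimodular P ρ) {m δ : T → ℝ} {x B : ℝ}
    (hx : 0 < x) (hm : Measurable m) (hm0 : ∀ t, 0 ≤ m t) (hδ : Measurable δ)
    (hδB : ∀ t, |δ t| ≤ B)
    (hlaw : (rootLaw ρ μ).map (fun p => (x + ∑ i ∈ Finset.range p.1, m (p.2 i))⁻¹) = μ.map m) :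
    ∫ p, (∑ i ∈ Finset.range p.1, δ (p.2 i)) / (x + ∑ i ∈ Finset.range p.1, m (p.2 i)) ∂rootLaw P μ
      = (mean P).toReal * ∫ q, δ q.1 * m q.2 / (1 + m q.1 * m q.2) ∂μ.prod μ := by
  have hspos : ∀ (k : ℕ) (ω : ℕ → T), x ≤ x + ∑ i ∈ Finset.range k, m (ω i) := fun k ω =>
    le_add_of_nonneg_right (Finset.sum_nonneg fun i _ => hm0 _)
  have hmS : Measurable fun p : ℕ × (ℕ → T) => ∑ i ∈ Finset.range p.1, m (p.2 i) :=
    measurable_sum_range measurable_fst fun i => by fun_prop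
  have hdS : Measurable fun p : ℕ × (ℕ → T) => ∑ i ∈ Finset.range p.1, δ (p.2 i) :=
    measurable_sum_range measurable_fst fun i => by fun_prop
  have hint : Integrable (fun p : ℕ × (ℕ → T) => (∑ i ∈ Finset.range p.1, δ (p.2 i))
      / (x + ∑ i ∈ Finset.range p.1, m (p.2 i))) (rootLaw P μ) := by
    refine Integrable.mono' ((integrable_fst_rootLaw μ hPρ.1).mul_const (B / x))
      (hdS.div (hmS.const_add x)).aestronglyMeasurable (Eventually.of_forall fun p => ?_)
    rw [Real.norm_eq_abs, abs_div, abs_of_pos (hx.trans_le (hspos _ _)), ← mul_div_assoc]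
    refine div_le_div₀ ?_ ?_ hx (hspos _ _)
    · exact mul_nonneg (Nat.cast_nonneg _) ((abs_nonneg _).trans (hδB (p.2 0)))
    · refine (Finset.abs_sum_le_sum_abs _ _).trans
        ((Finset.sum_le_sum fun i _ => hδB (p.2 i)).trans ?_)
      simp
  set c : ℕ → ℝ := fun k => ∫ ω, δ (ω 0) / (x + ∑ j ∈ Finset.range (k + 1), m (ω j))
    ∂(Measure.infinitePi fun _ : ℕ => μ) with hc
  have hgm : Measurable (Function.uncurry fun (t : T) (s : ℝ) => δ t / (x + s)) :=
    (hδ.comp measurable_fst).div (measurable_snd.const_add x)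
  have hinner : ∀ k : ℕ, ∫ ω, (∑ i ∈ Finset.range k, δ (ω i))
      / (x + ∑ i ∈ Finset.range k, m (ω i)) ∂(Measure.infinitePi fun _ : ℕ => μ)
      = k * c (k - 1) := by
    intro k
    simp_rw [Finset.sum_div]
    rw [integral_finsetSum]
    · have : ∀ i ∈ Finset.range k, ∫ ω, δ (ω i) / (x + ∑ j ∈ Finset.range k, m (ω j))
          ∂(Measure.infinitePi fun _ : ℕ => μ) = c (k - 1) := by
        intro i hi
        have hi' := Finset.mem_range.1 hi
        rw [hc, integral_infinitePi_swap μ hgm hm hi']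
        simp only
        rw [Nat.sub_add_cancel (by omega)]
      rw [Finset.sum_congr rfl this]
      simp
    · intro i _
      refine Integrable.of_bound (C := B / x) ?_ (Eventually.of_forall fun ω => ?_)
      · exact (hgm.comp ((measurable_pi_apply i).prodMk (Finset.measurable_sum (Finset.range k)
          fun j _ => hm.comp (measurable_pi_apply j)))).aestronglyMeasurable
      · rw [Real.norm_eq_abs, abs_div, abs_of_pos (hx.trans_le (hspos _ _))]
        exact div_le_div₀ ((abs_nonneg _).trans (hδB (ω i))) (hδB _) hx (hspos _ _)
  have hunim : ∀ k : ℕ, (P (k + 1)).toReal * ((k + 1 : ℕ) * c k)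
      = (mean P).toReal * ((ρ k).toReal * c k) := by
    intro k
    have h := congrArg ENNReal.toReal (hPρ.2 k)
    rw [ENNReal.toReal_mul, ENNReal.toReal_mul] at h
    have e : ((k : ℝ≥0∞) + 1).toReal = ((k + 1 : ℕ) : ℝ) := by
      rw [← Nat.cast_add_one, ENNReal.toReal_natCast]
    rw [e] at h
    rw [← mul_assoc, ← mul_assoc, h]
    ring
  set G : T × (ℕ × (ℕ → T)) → ℝ := fun q =>
    δ q.1 / (x + (m q.1 + ∑ i ∈ Finset.range q.2.1, m (q.2.2 i))) with hG
  have hGm : Measurable G := (hδ.comp measurable_fst).div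
    (((hm.comp measurable_fst).add (hmS.comp measurable_snd)).const_add x)
  have hGB : ∀ q, ‖G q‖ ≤ B / x := by
    intro q
    have h1 : x ≤ x + (m q.1 + ∑ i ∈ Finset.range q.2.1, m (q.2.2 i)) :=
      le_add_of_nonneg_right (add_nonneg (hm0 _) (Finset.sum_nonneg fun i _ => hm0 _))
    rw [hG, Real.norm_eq_abs, abs_div, abs_of_pos (hx.trans_le h1)]
    exact div_le_div₀ ((abs_nonneg _).trans (hδB q.1)) (hδB _) hx h1
  have hGi : Integrable G (μ.prod (rootLaw ρ μ)) :=
    Integrable.of_bound hGm.aestronglyMeasurable (B / x) (Eventually.of_forall hGB)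
  have hck : ∀ k : ℕ, c k = ∫ ω, ∫ t, G (t, (k, ω)) ∂μ ∂(Measure.infinitePi fun _ : ℕ => μ) := by
    intro k
    have hGk : Measurable fun q : T × (ℕ → T) => G (q.1, (k, q.2)) :=
      hGm.comp (measurable_fst.prodMk (measurable_const.prodMk measurable_snd))
    have hi : Integrable (fun q : T × (ℕ → T) => G (q.1, (k, q.2)))
        (μ.prod (Measure.infinitePi fun _ : ℕ => μ)) :=
      Integrable.of_bound hGk.aestronglyMeasurable (B / x) (Eventually.of_forall fun q => hGB _)
    rw [← integral_prod_symm _ hi, ← infinitePi_nat_map_split,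
      integral_map (by fun_prop) hGk.aestronglyMeasurable]
    simp only [hc, hG, Finset.sum_range_succ', add_comm]
  have hsum : ∑' k : ℕ, (ρ k).toReal * c k = ∫ q, G q ∂μ.prod (rootLaw ρ μ) := by
    rw [integral_prod_symm _ hGi, integral_rootLaw μ hGi.integral_prod_right]
    simp_rw [hck]
  have hfin : ∫ q, G q ∂μ.prod (rootLaw ρ μ)
      = ∫ q, δ q.1 * m q.2 / (1 + m q.1 * m q.2) ∂μ.prod μ := by
    have hum : Measurable fun p : ℕ × (ℕ → T) => (x + ∑ i ∈ Finset.range p.1, m (p.2 i))⁻¹ :=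
      (hmS.const_add x).inv
    have hb : ∀ s t, |δ s * m t / (1 + m s * m t)| ≤ B * m t := by
      intro s t
      have h1 : 1 ≤ 1 + m s * m t := le_add_of_nonneg_right (mul_nonneg (hm0 _) (hm0 _))
      rw [abs_div, abs_of_pos (one_pos.trans_le h1), abs_mul, abs_of_nonneg (hm0 t)]
      exact (div_le_self (mul_nonneg (abs_nonneg _) (hm0 t)) h1).trans
        (mul_le_mul_of_nonneg_right (hδB s) (hm0 t))
    have hmle : ∀ᵐ t ∂μ, m t ≤ x⁻¹ := by
      have h1 : ∀ᵐ r ∂(rootLaw ρ μ).map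
          (fun p => (x + ∑ i ∈ Finset.range p.1, m (p.2 i))⁻¹), r ≤ x⁻¹ :=
        (ae_map_iff hum.aemeasurable measurableSet_Iic).2
          (Eventually.of_forall fun p => inv_anti₀ hx (hspos _ _))
      rw [hlaw] at h1
      exact ae_of_ae_map hm.aemeasurable h1
    have hmp : Measurable fun q : T × T => δ q.1 * m q.2 / (1 + m q.1 * m q.2) := by fun_prop
    have hi : Integrable (fun q : T × T => δ q.1 * m q.2 / (1 + m q.1 * m q.2)) (μ.prod μ) := by
      refine Integrable.of_bound hmp.aestronglyMeasurable (B * x⁻¹) ?_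
      filter_upwards [Measure.quasiMeasurePreserving_snd.ae hmle] with q hq
      exact (hb q.1 q.2).trans
        (mul_le_mul_of_nonneg_left hq ((abs_nonneg _).trans (hδB q.1)))
    rw [integral_prod _ hGi, integral_prod _ hi]
    refine integral_congr_ae (Eventually.of_forall fun s => ?_)
    have hgs : Measurable fun u : ℝ => δ s * u / (1 + m s * u) := by fun_prop
    have h1 := integral_map (μ := rootLaw ρ μ) hum.aemeasurable hgs.aestronglyMeasurable
    have h2 := integral_map (μ := μ) hm.aemeasurable hgs.aestronglyMeasurable
    rw [hlaw] at h1
    refine Eq.trans ?_ (h1.symm.trans h2)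
    refine integral_congr_ae (Eventually.of_forall fun p => ?_)
    have h3 := hx.trans_le (hspos p.1 p.2)
    have h4 : 0 < m s + (x + ∑ i ∈ Finset.range p.1, m (p.2 i)) := add_pos_of_nonneg_of_pos (hm0 s) h3
    simp only [hG]
    field_simp
    ring_nf
  rw [integral_rootLaw μ hint, ← hfin, ← hsum, ← tsum_mul_left]
  have h0 : ∑' k : ℕ, (P k).toReal * ((k : ℝ) * c (k - 1))
      = ∑' k : ℕ, (P (k + 1)).toReal * ((k + 1 : ℕ) * c k) := by
    refine ((add_left_injective 1).tsum_eq
      (f := fun k : ℕ => (P k).toReal * ((k : ℝ) * c (k - 1))) ?_).symm.trans ?_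
    · intro k hk
      rcases k with _ | k
      · simp at hk
      · exact ⟨k, rfl⟩
    · simp
  simp_rw [hinner, h0, hunim]

end RootIntegrals

/-- The limiting pressure in terms of the messages on the Galton-Watson tree. -/
def pressure (P ρ : PMF ℕ) (x : ℝ) : ℝ :=
  (∫ p, Real.log (x + ∑ i ∈ Finset.range p.1, treeLim x (p.2 i)) ∂rootLaw P (offspringLaw ρ ρ))
    - (mean P).toReal / 2 * ∫ q, Real.log (1 + treeLim x q.1 * treeLim x q.2)
      ∂(offspringLaw ρ ρ).prod (offspringLaw ρ ρ)

lemma abs_log_add_sub_log_sub_div_le {s η a b : ℝ} (ha : 0 < a) (hb : 0 < b) (has : a ≤ s)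
    (hbs : b ≤ s + η) : |Real.log (s + η) - Real.log s - η / s| ≤ η ^ 2 / (a * b) := by
  have hs : 0 < s := ha.trans_le has
  have hs' : 0 < s + η := hb.trans_le hbs
  have h1 : Real.log (s + η) - Real.log s ≤ η / s := by
    rw [← Real.log_div hs'.ne' hs.ne']
    refine (Real.log_le_sub_one_of_pos (div_pos hs' hs)).trans_eq ?_
    field_simp
    ring
  have h2 : η / s - η ^ 2 / (s * (s + η)) ≤ Real.log (s + η) - Real.log s := by
    have h := Real.log_le_sub_one_of_pos (div_pos hs hs')
    rw [Real.log_div hs.ne' hs'.ne'] at h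
    have e : η / s - η ^ 2 / (s * (s + η)) = 1 - s / (s + η) := by
      field_simp
      ring
    linarith
  have h3 : η ^ 2 / (s * (s + η)) ≤ η ^ 2 / (a * b) := by gcongr
  rw [abs_le]
  have h4 : 0 ≤ η ^ 2 / (a * b) := by positivity
  constructor <;> linarith

lemma measurable_sum_treeLim (x : ℝ) : Measurable fun p : ℕ × (ℕ → List ℕ → ℕ) =>
    ∑ i ∈ Finset.range p.1, treeLim x (p.2 i) :=
  measurable_sum_range measurable_fst fun i => by fun_prop

lemma sum_treeLim_nonneg {x : ℝ} (hx : 0 < x) (p : ℕ × (ℕ → List ℕ → ℕ)) :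
    0 ≤ ∑ i ∈ Finset.range p.1, treeLim x (p.2 i) :=
  Finset.sum_nonneg fun _ _ => treeLim_nonneg hx _

lemma log_add_sum_treeLim_bounds {x : ℝ} (hx : 0 < x) (p : ℕ × (ℕ → List ℕ → ℕ)) :
    Real.log x ≤ Real.log (x + ∑ i ∈ Finset.range p.1, treeLim x (p.2 i)) ∧
    Real.log (x + ∑ i ∈ Finset.range p.1, treeLim x (p.2 i)) ≤ Real.log x + p.1 * (x ^ 2)⁻¹ := by
  have h0 := sum_treeLim_nonneg hx p
  have hpos : 0 < x + ∑ i ∈ Finset.range p.1, treeLim x (p.2 i) := by positivity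
  refine ⟨Real.log_le_log hx (by linarith), ?_⟩
  have h1 : ∑ i ∈ Finset.range p.1, treeLim x (p.2 i) ≤ p.1 * x⁻¹ := by
    refine (Finset.sum_le_sum fun i _ => treeLim_le hx (p.2 i)).trans ?_
    simp
  have h2 := Real.log_le_sub_one_of_pos (div_pos hpos hx)
  rw [Real.log_div hpos.ne' hx.ne'] at h2
  have h3 : (x + ∑ i ∈ Finset.range p.1, treeLim x (p.2 i)) / x - 1 ≤ p.1 * (x ^ 2)⁻¹ := by
    have e : (x + ∑ i ∈ Finset.range p.1, treeLim x (p.2 i)) / x - 1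
      = (∑ i ∈ Finset.range p.1, treeLim x (p.2 i)) * x⁻¹ := by field_simp; ring
    rw [e, sq, mul_inv, ← mul_assoc]
    exact mul_le_mul_of_nonneg_right h1 (inv_pos.2 hx).le
  linarith

lemma integrable_log_add_sum_treeLim {P ρ : PMF ℕ} (hP : mean P ≠ ∞) {x : ℝ} (hx : 0 < x) :
    Integrable (fun p => Real.log (x + ∑ i ∈ Finset.range p.1, treeLim x (p.2 i)))
      (rootLaw P (offspringLaw ρ ρ)) := by
  refine Integrable.mono' ((integrable_const |Real.log x|).add
    ((integrable_fst_rootLaw (offspringLaw ρ ρ) hP).mul_const (x ^ 2)⁻¹))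
    (((measurable_sum_treeLim x).const_add x).log).aestronglyMeasurable
    (Eventually.of_forall fun p => ?_)
  have h := log_add_sum_treeLim_bounds hx p
  have h1 : 0 ≤ (p.1 : ℝ) * (x ^ 2)⁻¹ := by positivity
  rw [Real.norm_eq_abs, abs_le]
  simp only [Pi.add_apply]
  exact ⟨by linarith [neg_abs_le (Real.log x)], by linarith [le_abs_self (Real.log x)]⟩

lemma treeLim_mul_bounds {x : ℝ} (hx : 0 < x) (K L : List ℕ → ℕ) :
    0 ≤ treeLim x K * treeLim x L ∧ treeLim x K * treeLim x L ≤ (x ^ 2)⁻¹ := by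
  refine ⟨mul_nonneg (treeLim_nonneg hx K) (treeLim_nonneg hx L), ?_⟩
  rw [sq, mul_inv]
  exact mul_le_mul (treeLim_le hx K) (treeLim_le hx L) (treeLim_nonneg hx L) (inv_pos.2 hx).le

lemma log_one_add_treeLim_mul_bounds {x : ℝ} (hx : 0 < x) (K L : List ℕ → ℕ) :
    0 ≤ Real.log (1 + treeLim x K * treeLim x L) ∧
      Real.log (1 + treeLim x K * treeLim x L) ≤ (x ^ 2)⁻¹ := by
  have h := treeLim_mul_bounds hx K L
  refine ⟨Real.log_nonneg (by linarith), ?_⟩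
  have := Real.log_le_sub_one_of_pos (show 0 < 1 + treeLim x K * treeLim x L by linarith)
  linarith

lemma integrable_log_one_add_treeLim_mul {ρ : PMF ℕ} {x : ℝ} (hx : 0 < x) :
    Integrable (fun q : (List ℕ → ℕ) × (List ℕ → ℕ) =>
      Real.log (1 + treeLim x q.1 * treeLim x q.2))
      ((offspringLaw ρ ρ).prod (offspringLaw ρ ρ)) := by
  refine Integrable.of_bound (Measurable.aestronglyMeasurable (by fun_prop)) (x ^ 2)⁻¹
    (Eventually.of_forall fun q => ?_)
  have h := log_one_add_treeLim_mul_bounds hx q.1 q.2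
  rw [Real.norm_eq_abs, abs_of_nonneg h.1]
  exact h.2

lemma map_pair_rootLaw {T : Type*} [MeasurableSpace T] (Q : PMF ℕ) (μ : Measure T)
    [IsProbabilityMeasure μ] : (rootLaw Q μ).map (fun p => (p.2 0, p.2 1)) = μ.prod μ := by
  have h : (fun p : ℕ × (ℕ → T) => (p.2 0, p.2 1)) = (fun ω => (ω 0, ω 1)) ∘ Prod.snd := rfl
  rw [h, ← Measure.map_map (by fun_prop) measurable_snd, rootLaw, Measure.map_snd_prod,
    measure_univ, one_smul]
  exact Measure.infinitePi_map_eval_prod (P := fun _ : ℕ => μ) zero_ne_one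

section LimitLaw

variable {P ρ : PMF ℕ} {x : ℝ}

lemma measurable_vertexTerm (x : ℝ) : Measurable (vertexTerm x) :=
  ((measurable_sum_range measurable_fst fun i => by fun_prop).const_add x).log

lemma measurable_edgeTerm (x : ℝ) : Measurable (edgeTerm x) := by
  unfold edgeTerm; fun_prop

lemma vertexTerm_comp (hx : 0 < x) :
    vertexTerm x ∘ (fun p : ℕ × (ℕ → List ℕ → ℕ) => (p.1, fun i => x * treeLim x (p.2 i)))
      = fun p => Real.log (x + ∑ i ∈ Finset.range p.1, treeLim x (p.2 i)) := by
  funext p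
  simp [vertexTerm, mul_div_cancel_left₀ _ hx.ne']

lemma edgeTerm_comp (hx : 0 < x) :
    edgeTerm x ∘ (fun p : ℕ × (ℕ → List ℕ → ℕ) => (p.1, fun i => x * treeLim x (p.2 i)))
      = (fun q : (List ℕ → ℕ) × (List ℕ → ℕ) => Real.log (1 + treeLim x q.1 * treeLim x q.2))
        ∘ (fun p => (p.2 0, p.2 1)) := by
  funext p
  simp [edgeTerm, mul_div_cancel_left₀ _ hx.ne']

theorem integrable_vertexTerm (hP : mean P ≠ ∞) (hx : 0 < x) :
    Integrable (vertexTerm x) (jointLaw P (limitLaw ρ x)) := by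
  rw [jointLaw_limitLaw, integrable_map_measure (measurable_vertexTerm x).aestronglyMeasurable
    (by fun_prop), vertexTerm_comp hx]
  exact integrable_log_add_sum_treeLim hP hx

theorem integrable_edgeTerm (hx : 0 < x) :
    Integrable (edgeTerm x) (jointLaw P (limitLaw ρ x)) := by
  rw [jointLaw_limitLaw, integrable_map_measure (measurable_edgeTerm x).aestronglyMeasurable
    (by fun_prop), edgeTerm_comp hx, ← integrable_map_measure
    (Measurable.aestronglyMeasurable (by fun_prop)) (by fun_prop), map_pair_rootLaw]
  exact integrable_log_one_add_treeLim_mul hx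

lemma limitPressure_limitLaw (hx : 0 < x) :
    limitPressure P (limitLaw ρ x) x = pressure P ρ x := by
  have hm : Measurable fun p : ℕ × (ℕ → List ℕ → ℕ) => (p.1, fun i => x * treeLim x (p.2 i)) := by
    fun_prop
  rw [limitPressure, pressure, jointLaw_limitLaw,
    integral_map hm.aemeasurable (measurable_vertexTerm x).aestronglyMeasurable,
    integral_map hm.aemeasurable (measurable_edgeTerm x).aestronglyMeasurable]
  have h1 := vertexTerm_comp hx
  have h2 := edgeTerm_comp hx
  have h3 := integral_map (μ := rootLaw P (offspringLaw ρ ρ))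
    (φ := fun p : ℕ × (ℕ → List ℕ → ℕ) => (p.2 0, p.2 1))
    (f := fun q : (List ℕ → ℕ) × (List ℕ → ℕ) => Real.log (1 + treeLim x q.1 * treeLim x q.2))
    (by fun_prop) (Measurable.aestronglyMeasurable (by fun_prop))
  rw [map_pair_rootLaw] at h3
  rw [h3]
  congr 1
  · exact integral_congr_ae (Eventually.of_forall fun p => congrFun h1 p)
  · congr 1
    exact integral_congr_ae (Eventually.of_forall fun p => congrFun h2 p)

end LimitLaw

lemma abs_pressure_sub_log_le {P : PMF ℕ} (ρ : PMF ℕ) (hP : mean P ≠ ∞) {x : ℝ} (hx : 0 < x) :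
    |pressure P ρ x - Real.log x| ≤ 2 * (mean P).toReal * (x ^ 2)⁻¹ := by
  set a := ∫ p, Real.log (x + ∑ i ∈ Finset.range p.1, treeLim x (p.2 i))
    ∂rootLaw P (offspringLaw ρ ρ) with ha
  set b := ∫ q : (List ℕ → ℕ) × (List ℕ → ℕ), Real.log (1 + treeLim x q.1 * treeLim x q.2)
      ∂(offspringLaw ρ ρ).prod (offspringLaw ρ ρ) with hb
  have hlog : ∫ _ : ℕ × (ℕ → List ℕ → ℕ), Real.log x ∂rootLaw P (offspringLaw ρ ρ) = Real.log x := by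
    simp
  have h1 : Real.log x ≤ a := by
    rw [← hlog]
    exact integral_mono (integrable_const _) (integrable_log_add_sum_treeLim hP hx)
      fun p => (log_add_sum_treeLim_bounds hx p).1
  have hi := (integrable_fst_rootLaw (offspringLaw ρ ρ) hP).mul_const (x ^ 2)⁻¹
  have h2 : a ≤ Real.log x + (mean P).toReal * (x ^ 2)⁻¹ := by
    have hi' : Integrable (fun p : ℕ × (ℕ → List ℕ → ℕ) => Real.log x + p.1 * (x ^ 2)⁻¹)
        (rootLaw P (offspringLaw ρ ρ)) := (integrable_const _).add hi
    have := integral_mono (integrable_log_add_sum_treeLim hP hx) hi' fun p => (log_add_sum_treeLim_bounds hx p).2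
    rwa [integral_add (integrable_const _) hi, hlog, integral_mul_const,
      integral_fst_rootLaw] at this
  have h3 : 0 ≤ b := integral_nonneg fun q => (log_one_add_treeLim_mul_bounds hx q.1 q.2).1
  have h4 : b ≤ (x ^ 2)⁻¹ := by
    have := integral_mono (integrable_log_one_add_treeLim_mul (ρ := ρ) hx)
      (integrable_const (x ^ 2)⁻¹) fun q => (log_one_add_treeLim_mul_bounds hx q.1 q.2).2
    simpa using this
  have hm : 0 ≤ (mean P).toReal := ENNReal.toReal_nonneg
  have h5 : (mean P).toReal * b ≤ (mean P).toReal * (x ^ 2)⁻¹ := mul_le_mul_of_nonneg_left h4 hm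
  have h6 : 0 ≤ (mean P).toReal * b := mul_nonneg hm h3
  have h7 : pressure P ρ x = a - (mean P).toReal / 2 * b := rfl
  rw [h7, abs_le]
  constructor <;> nlinarith

lemma Settles.abs_treeLim_sub_le {K : List ℕ → ℕ} (hK : Settles K) {x y : ℝ} (hx : 0 < x)
    (hy : x / 2 ≤ y) : |treeLim y K - treeLim x K| ≤ 2 * (x ^ 2)⁻¹ * |y - x| := by
  have hy0 : 0 < y := by linarith
  have hm := treeLim_nonneg hx K
  have hm1 : treeLim x K * x ≤ 1 := by
    have := mul_le_mul_of_nonneg_right (treeLim_le hx K) hx.le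
    rwa [inv_mul_cancel₀ hx.ne'] at this
  have key : x ^ 2 * |treeLim y K - treeLim x K| ≤ 2 * |y - x| := by
    rcases le_total x y with h | h
    · obtain ⟨h1, h2⟩ := hK.mul_treeLim_le hx h
      rw [abs_of_nonneg (sub_nonneg.2 h), ← abs_of_pos (show 0 < x ^ 2 by positivity), ← abs_mul,
        abs_le]
      constructor
      · have : y * (x * (treeLim x K - treeLim y K)) ≤ y * (2 * (y - x) / x) := by
          have e : y * (2 * (y - x) / x) = (y - x) / x * (2 * y) := by ring
          have h3 : y * (x * (treeLim x K - treeLim y K)) ≤ (y - x) * (x * treeLim x K) := by nlinarith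
          have h4 : (y - x) * (x * treeLim x K) ≤ (y - x) * 1 :=
            mul_le_mul_of_nonneg_left (by linarith) (by linarith)
          have h5 : y - x ≤ (y - x) / x * (2 * y) := by
            rw [div_mul_eq_mul_div, le_div_iff₀ hx]
            nlinarith
          linarith
        have h6 := le_of_mul_le_mul_left this hy0
        rw [le_div_iff₀ hx] at h6
        nlinarith
      · nlinarith
    · obtain ⟨h1, h2⟩ := hK.mul_treeLim_le hy0 h
      rw [abs_of_nonpos (sub_nonpos.2 h), ← abs_of_pos (show 0 < x ^ 2 by positivity), ← abs_mul,
        abs_le]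
      constructor
      · have : x ^ 2 * (treeLim x K - treeLim y K) ≤ (x - y) * (x * treeLim x K) := by nlinarith
        nlinarith
      · have h3 : y * (treeLim y K - treeLim x K) ≤ (x - y) * treeLim x K := by nlinarith
        by_cases hd : treeLim y K - treeLim x K ≤ 0
        · nlinarith [mul_nonneg (sq_nonneg x) (neg_nonneg.2 hd)]
        · push Not at hd
          have h4 : x * (treeLim y K - treeLim x K) ≤ 2 * ((x - y) * treeLim x K) := by nlinarith
          nlinarith [mul_le_mul_of_nonneg_left h4 hx.le]
  have hx2 : 0 < x ^ 2 := by positivity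
  rw [mul_assoc, mul_comm (x ^ 2)⁻¹, ← mul_assoc, ← div_eq_mul_inv, le_div_iff₀ hx2]
  linarith

lemma mean_ne_top_of_secondMoment {P : PMF ℕ} (hP : secondMoment P ≠ ∞) : mean P ≠ ∞ := by
  refine ne_top_of_le_ne_top hP (ENNReal.tsum_le_tsum fun k => ?_)
  gcongr
  rcases k with _ | k
  · simp
  · exact le_self_pow₀ (by simp) two_ne_zero

section Derivative

variable {P ρ : PMF ℕ} {x y : ℝ}

lemma abs_integral_vertex_increment_le (hP : secondMoment P ≠ ∞) (hρ : mean ρ ≠ ∞) (hx : 0 < x)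
    (hy : x / 2 ≤ y) :
    |(∫ p, Real.log (y + ∑ i ∈ Finset.range p.1, treeLim y (p.2 i)) ∂rootLaw P (offspringLaw ρ ρ))
      - (∫ p, Real.log (x + ∑ i ∈ Finset.range p.1, treeLim x (p.2 i)) ∂rootLaw P (offspringLaw ρ ρ))
      - (y - x) * (∫ p, rootMsg x p ∂rootLaw P (offspringLaw ρ ρ))
      - ∫ p, (∑ i ∈ Finset.range p.1, (treeLim y (p.2 i) - treeLim x (p.2 i)))
          / (x + ∑ i ∈ Finset.range p.1, treeLim x (p.2 i)) ∂rootLaw P (offspringLaw ρ ρ)|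
    ≤ (2 * (x ^ 2)⁻¹ * (2 + 2 * (2 * (x ^ 2)⁻¹) ^ 2
        * ∫ p, (p.1 : ℝ) ^ 2 ∂rootLaw P (offspringLaw ρ ρ))) * (y - x) ^ 2 := by
  have hP1 := mean_ne_top_of_secondMoment hP
  have hy0 : 0 < y := by linarith
  set D : ℝ := 2 * (x ^ 2)⁻¹ with hD
  have hD0 : 0 ≤ D := by positivity
  have hs : ∀ p : ℕ × (ℕ → List ℕ → ℕ), x ≤ x + ∑ i ∈ Finset.range p.1, treeLim x (p.2 i) :=
    fun p => le_add_of_nonneg_right (sum_treeLim_nonneg hx p)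
  have hA : ∀ᵐ p ∂rootLaw P (offspringLaw ρ ρ), |∑ i ∈ Finset.range p.1, (treeLim y (p.2 i) - treeLim x (p.2 i))|
      ≤ p.1 * (D * |y - x|) := by
    filter_upwards [ae_rootLaw P (offspringLaw ρ ρ) (ae_settles hρ)] with p hp
    refine (Finset.abs_sum_le_sum_abs _ _).trans
      ((Finset.sum_le_sum fun i _ => (hp i).abs_treeLim_sub_le hx hy).trans ?_)
    simp [hD]
  have hAm : Measurable fun p : ℕ × (ℕ → List ℕ → ℕ) =>
      ∑ i ∈ Finset.range p.1, (treeLim y (p.2 i) - treeLim x (p.2 i)) :=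
    measurable_sum_range measurable_fst fun i => by fun_prop
  have hi1 := integrable_log_add_sum_treeLim (ρ := ρ) hP1 hy0
  have hi2 := integrable_log_add_sum_treeLim (ρ := ρ) hP1 hx
  have hi3 : Integrable (fun p => (y - x) * rootMsg x p) (rootLaw P (offspringLaw ρ ρ)) := by
    refine Integrable.const_mul (Integrable.of_bound (measurable_rootMsg x).aestronglyMeasurable
      x⁻¹ (Eventually.of_forall fun p => ?_)) _
    rw [Real.norm_eq_abs, rootMsg, abs_inv, abs_of_pos (hx.trans_le (hs p))]
    exact inv_anti₀ hx (hs p)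
  have hi4 : Integrable (fun p : ℕ × (ℕ → List ℕ → ℕ) =>
      (∑ i ∈ Finset.range p.1, (treeLim y (p.2 i) - treeLim x (p.2 i)))
          / (x + ∑ i ∈ Finset.range p.1, treeLim x (p.2 i))) (rootLaw P (offspringLaw ρ ρ)) := by
    refine Integrable.mono' ((integrable_fst_rootLaw _ hP1).mul_const (D * |y - x| / x))
      (hAm.div ((measurable_sum_treeLim x).const_add x)).aestronglyMeasurable ?_
    filter_upwards [hA] with p hp
    rw [Real.norm_eq_abs, abs_div, abs_of_pos (hx.trans_le (hs p)), ← mul_div_assoc]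
    exact div_le_div₀ (by positivity) hp hx (hs p)
  have hsq := integrable_fst_sq_rootLaw (offspringLaw ρ ρ) hP
  have hi5 : Integrable (fun p : ℕ × (ℕ → List ℕ → ℕ) =>
      (D * (2 + 2 * D ^ 2 * (p.1 : ℝ) ^ 2)) * (y - x) ^ 2) (rootLaw P (offspringLaw ρ ρ)) :=
    (((integrable_const (2 : ℝ)).add (hsq.const_mul (2 * D ^ 2))).const_mul D).mul_const _
  have e2 : ∫ p, (D * (2 + 2 * D ^ 2 * (p.1 : ℝ) ^ 2)) * (y - x) ^ 2 ∂rootLaw P (offspringLaw ρ ρ)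
      = D * (2 + 2 * D ^ 2 * ∫ p, (p.1 : ℝ) ^ 2 ∂rootLaw P (offspringLaw ρ ρ)) * (y - x) ^ 2 := by
    rw [integral_mul_const, integral_const_mul, integral_add (integrable_const _)
      (hsq.const_mul _), integral_const_mul]
    simp
  have hi12 : Integrable (fun p => Real.log (y + ∑ i ∈ Finset.range p.1, treeLim y (p.2 i))
      - Real.log (x + ∑ i ∈ Finset.range p.1, treeLim x (p.2 i))) (rootLaw P (offspringLaw ρ ρ)) :=
    hi1.sub hi2
  have hi123 : Integrable (fun p => Real.log (y + ∑ i ∈ Finset.range p.1, treeLim y (p.2 i))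
      - Real.log (x + ∑ i ∈ Finset.range p.1, treeLim x (p.2 i)) - (y - x) * rootMsg x p)
      (rootLaw P (offspringLaw ρ ρ)) := hi12.sub hi3
  rw [← integral_sub hi1 hi2, ← integral_const_mul, ← integral_sub hi12 hi3,
    ← integral_sub hi123 hi4, ← Real.norm_eq_abs, ← e2]
  refine norm_integral_le_of_norm_le hi5 ?_
  filter_upwards [hA] with p hp
  set s := x + ∑ i ∈ Finset.range p.1, treeLim x (p.2 i) with hs'
  set A := ∑ i ∈ Finset.range p.1, (treeLim y (p.2 i) - treeLim x (p.2 i)) with hA'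
  have e1 : y + ∑ i ∈ Finset.range p.1, treeLim y (p.2 i) = s + ((y - x) + A) := by
    rw [hs', hA', Finset.sum_sub_distrib]
    ring
  have h1 := abs_log_add_sub_log_sub_div_le (s := s) (η := (y - x) + A) hx
    (show 0 < x / 2 by linarith) (hs p) (by
      rw [← e1]
      exact hy.trans (le_add_of_nonneg_right (sum_treeLim_nonneg hy0 p)))
  rw [Real.norm_eq_abs, e1]
  have e3 : Real.log (s + (y - x + A)) - Real.log s - (y - x) * rootMsg x p - A / s
      = Real.log (s + (y - x + A)) - Real.log s - (y - x + A) / s := by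
    have : rootMsg x p = s⁻¹ := rfl
    rw [this]
    ring
  rw [e3]
  refine h1.trans ?_
  have h2 : A ^ 2 ≤ (p.1 * (D * |y - x|)) ^ 2 := sq_le_sq' (abs_le.1 hp).1 (abs_le.1 hp).2
  have h3 : (p.1 * (D * |y - x|)) ^ 2 = D ^ 2 * (p.1 : ℝ) ^ 2 * (y - x) ^ 2 := by
    rw [mul_pow, mul_pow, sq_abs]; ring
  have h4 : (y - x + A) ^ 2 ≤ (2 + 2 * D ^ 2 * (p.1 : ℝ) ^ 2) * (y - x) ^ 2 := by
    nlinarith [sq_nonneg (y - x - A)]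
  have e4 : (y - x + A) ^ 2 / (x * (x / 2)) = D * (y - x + A) ^ 2 := by
    rw [hD]; field_simp
  rw [e4]
  exact (mul_le_mul_of_nonneg_left h4 hD0).trans_eq (mul_assoc _ _ _).symm

lemma abs_integral_edge_increment_le (hρ : mean ρ ≠ ∞) (hx : 0 < x) (hy : x / 2 ≤ y) :
    |(∫ q, Real.log (1 + treeLim y q.1 * treeLim y q.2) ∂(offspringLaw ρ ρ).prod (offspringLaw ρ ρ))
      - (∫ q, Real.log (1 + treeLim x q.1 * treeLim x q.2)
        ∂(offspringLaw ρ ρ).prod (offspringLaw ρ ρ))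
      - 2 * ∫ q, (treeLim y q.1 - treeLim x q.1) * treeLim x q.2
          / (1 + treeLim x q.1 * treeLim x q.2) ∂(offspringLaw ρ ρ).prod (offspringLaw ρ ρ)|
    ≤ ((2 * (x ^ 2)⁻¹) ^ 2 * (9 * (x ^ 2)⁻¹ + 1)) * (y - x) ^ 2 := by
  have hy0 : 0 < y := by linarith
  set D : ℝ := 2 * (x ^ 2)⁻¹ with hD
  have hD0 : 0 ≤ D := by positivity
  have hmul := fun q : (List ℕ → ℕ) × (List ℕ → ℕ) => treeLim_mul_bounds hx q.1 q.2
  have hδ : ∀ᵐ q ∂(offspringLaw ρ ρ).prod (offspringLaw ρ ρ), |treeLim y q.1 - treeLim x q.1| ≤ D * |y - x| ∧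
      |treeLim y q.2 - treeLim x q.2| ≤ D * |y - x| := by
    filter_upwards [Measure.quasiMeasurePreserving_fst.ae (ae_settles hρ),
      Measure.quasiMeasurePreserving_snd.ae (ae_settles hρ)] with q h1 h2
    exact ⟨h1.abs_treeLim_sub_le hx hy, h2.abs_treeLim_sub_le hx hy⟩
  have hi1 := integrable_log_one_add_treeLim_mul (ρ := ρ) hy0
  have hi2 := integrable_log_one_add_treeLim_mul (ρ := ρ) hx
  set f : (List ℕ → ℕ) × (List ℕ → ℕ) → ℝ := fun q => (treeLim y q.1 - treeLim x q.1) * treeLim x q.2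
    / (1 + treeLim x q.1 * treeLim x q.2) with hf
  have hfi : Integrable f ((offspringLaw ρ ρ).prod (offspringLaw ρ ρ)) := by
    refine Integrable.of_bound (Measurable.aestronglyMeasurable (by fun_prop))
      (D * |y - x| * x⁻¹) ?_
    filter_upwards [hδ] with q hq
    have h1 : 1 ≤ 1 + treeLim x q.1 * treeLim x q.2 := by linarith [(hmul q).1]
    rw [Real.norm_eq_abs, hf, abs_div, abs_of_pos (one_pos.trans_le h1), abs_mul,
      abs_of_nonneg (treeLim_nonneg hx q.2)]
    exact (div_le_self (mul_nonneg (abs_nonneg _) (treeLim_nonneg hx _)) h1).trans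
      (mul_le_mul hq.1 (treeLim_le hx _) (treeLim_nonneg hx _) (by positivity))
  have hfs : Integrable (fun q => f q.swap) ((offspringLaw ρ ρ).prod (offspringLaw ρ ρ)) := hfi.swap
  have e1 : ∫ q, f q.swap ∂(offspringLaw ρ ρ).prod (offspringLaw ρ ρ) = ∫ q, f q ∂(offspringLaw ρ ρ).prod (offspringLaw ρ ρ) := integral_prod_swap f
  have e2 : 2 * ∫ q, f q ∂(offspringLaw ρ ρ).prod (offspringLaw ρ ρ) = ∫ q, (f q + f q.swap) ∂(offspringLaw ρ ρ).prod (offspringLaw ρ ρ) := by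
    rw [integral_add hfi hfs, e1, two_mul]
  have hi12 : Integrable (fun q : (List ℕ → ℕ) × (List ℕ → ℕ) =>
      Real.log (1 + treeLim y q.1 * treeLim y q.2) - Real.log (1 + treeLim x q.1 * treeLim x q.2))
      ((offspringLaw ρ ρ).prod (offspringLaw ρ ρ)) := hi1.sub hi2
  have hff : Integrable (fun q => f q + f q.swap) ((offspringLaw ρ ρ).prod (offspringLaw ρ ρ)) :=
    hfi.add hfs
  rw [e2, ← integral_sub hi1 hi2, ← integral_sub hi12 hff, ← Real.norm_eq_abs]
  have e5 : ∫ _ : (List ℕ → ℕ) × (List ℕ → ℕ), (D ^ 2 * (9 * (x ^ 2)⁻¹ + 1)) * (y - x) ^ 2 ∂(offspringLaw ρ ρ).prod (offspringLaw ρ ρ)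
      = (D ^ 2 * (9 * (x ^ 2)⁻¹ + 1)) * (y - x) ^ 2 := by simp
  rw [← e5]
  refine norm_integral_le_of_norm_le (integrable_const _) ?_
  filter_upwards [hδ] with q hq
  obtain ⟨hq1, hq2⟩ := hq
  have hm1 := treeLim_nonneg hx q.1
  have hm2 := treeLim_nonneg hx q.2
  have hm2' := treeLim_le hx q.2
  have hn1 := treeLim_nonneg hy0 q.1
  have hn1' : treeLim y q.1 ≤ 2 * x⁻¹ := by
    refine (treeLim_le hy0 q.1).trans ?_
    rw [show 2 * x⁻¹ = (x / 2)⁻¹ by field_simp]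
    exact inv_anti₀ (by linarith) hy
  have hn2 := treeLim_nonneg hy0 q.2
  simp only [hf, Prod.fst_swap, Prod.snd_swap]
  generalize treeLim x q.1 = a at *
  generalize treeLim x q.2 = b at *
  generalize treeLim y q.1 = a' at *
  generalize treeLim y q.2 = b' at *
  have hab : 0 ≤ a * b := mul_nonneg hm1 hm2
  have hab' : 0 ≤ a' * b' := mul_nonneg hn1 hn2
  have h1 := abs_log_add_sub_log_sub_div_le (s := 1 + a * b) (η := a' * b' - a * b) one_pos one_pos
    (by linarith) (by linarith)
  have e3 : 1 + a * b + (a' * b' - a * b) = 1 + a' * b' := by ring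
  rw [e3] at h1
  have hη : |a' * b' - a * b| ≤ 3 * x⁻¹ * (D * |y - x|) := by
    have e : a' * b' - a * b = (a' - a) * b + a' * (b' - b) := by ring
    rw [e]
    refine (abs_add_le _ _).trans ?_
    rw [abs_mul, abs_mul, abs_of_nonneg hm2, abs_of_nonneg hn1]
    have t1 := mul_le_mul hq1 hm2' hm2 (by positivity)
    have t2 := mul_le_mul hn1' hq2 (abs_nonneg _) (by positivity)
    linarith
  have hη2 : (a' * b' - a * b) ^ 2 ≤ (3 * x⁻¹ * (D * |y - x|)) ^ 2 :=
    sq_le_sq' (abs_le.1 hη).1 (abs_le.1 hη).2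
  have hdd : |(a' - a) * (b' - b) / (1 + a * b)| ≤ (D * |y - x|) ^ 2 := by
    rw [abs_div, abs_of_pos (show 0 < 1 + a * b by linarith), abs_mul, sq]
    exact (div_le_self (by positivity) (by linarith)).trans
      (mul_le_mul hq1 hq2 (abs_nonneg _) (by positivity))
  have e4 : Real.log (1 + a' * b') - Real.log (1 + a * b)
      - ((a' - a) * b / (1 + a * b) + (b' - b) * a / (1 + b * a))
      = (Real.log (1 + a' * b') - Real.log (1 + a * b) - (a' * b' - a * b) / (1 + a * b))
        + (a' - a) * (b' - b) / (1 + a * b) := by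
    rw [mul_comm b a]
    ring
  rw [Real.norm_eq_abs, e4]
  refine (abs_add_le _ _).trans ((add_le_add h1 hdd).trans ?_)
  have e6 : (3 * x⁻¹ * (D * |y - x|)) ^ 2 = D ^ 2 * (9 * (x ^ 2)⁻¹) * (y - x) ^ 2 := by
    rw [mul_pow, mul_pow, mul_pow, sq_abs, inv_pow]; ring
  have e7 : (D * |y - x|) ^ 2 = D ^ 2 * (y - x) ^ 2 := by rw [mul_pow, sq_abs]
  rw [e7]
  rw [e6] at hη2
  simp only [mul_one, div_one]
  linarith

lemma hasDerivAt_pressure (hPρ : IsUnimodular P ρ) (hP : secondMoment P ≠ ∞) (hρ : mean ρ ≠ ∞)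
    (hx : 0 < x) :
    HasDerivAt (pressure P ρ) (∫ p, rootMsg x p ∂rootLaw P (offspringLaw ρ ρ)) x := by
  set C1 := (2 * (x ^ 2)⁻¹ * (2 + 2 * (2 * (x ^ 2)⁻¹) ^ 2
        * ∫ p, (p.1 : ℝ) ^ 2 ∂rootLaw P (offspringLaw ρ ρ))) with hC1
  set C2 := ((2 * (x ^ 2)⁻¹) ^ 2 * (9 * (x ^ 2)⁻¹ + 1)) with hC2
  set M := (mean P).toReal with hM
  have hM0 : 0 ≤ M := ENNReal.toReal_nonneg
  have hquad : ∀ y, x / 2 ≤ y →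
      |pressure P ρ y - pressure P ρ x
        - (y - x) * ∫ p, rootMsg x p ∂rootLaw P (offspringLaw ρ ρ)|
      ≤ (C1 + M / 2 * C2) * (y - x) ^ 2 := by
    intro y hy
    have hy0 : 0 < y := by linarith
    have h1 := abs_integral_vertex_increment_le hP hρ hx hy
    have h2 := abs_integral_edge_increment_le hρ hx hy
    have h3 := integral_sum_div_of_isUnimodular (offspringLaw ρ ρ) hPρ
      (m := treeLim x) (δ := fun K => treeLim y K - treeLim x K) (x := x) (B := y⁻¹ + x⁻¹) hx
      (measurable_treeLim x) (treeLim_nonneg hx) (by fun_prop) (fun K => by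
        have a1 := treeLim_nonneg hx K
        have a2 := treeLim_nonneg hy0 K
        have a3 := treeLim_le hx K
        have a4 := treeLim_le hy0 K
        rw [abs_le]
        constructor <;> linarith) (map_treeLim hρ hx)
    rw [h3] at h1
    rw [← hM] at h1
    have h4 := mul_le_mul_of_nonneg_left h2 (show 0 ≤ M / 2 by linarith)
    rw [← abs_of_nonneg (show 0 ≤ M / 2 by linarith), ← abs_mul,
      abs_of_nonneg (show 0 ≤ M / 2 by linarith)] at h4
    rw [pressure, pressure, ← hM]
    rw [abs_le] at h1 h4 ⊢
    constructor <;> linarith [h1.1, h1.2, h4.1, h4.2]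
  rw [hasDerivAt_iff_isLittleO]
  refine Asymptotics.IsBigO.trans_isLittleO (g := fun y => (y - x) ^ 2) ?_ ?_
  · refine Asymptotics.IsBigO.of_bound (C1 + M / 2 * C2) ?_
    filter_upwards [lt_mem_nhds (show x / 2 < x by linarith)] with y hy
    rw [smul_eq_mul, Real.norm_eq_abs, Real.norm_eq_abs, abs_of_nonneg (sq_nonneg (y - x))]
    exact hquad y hy.le
  · have h : Tendsto (fun y => y - x) (𝓝 x) (𝓝 0) := by
      have h0 : Tendsto (fun y => y - x) (𝓝 x) (𝓝 (x - x)) := tendsto_id.sub_const x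
      rwa [sub_self] at h0
    have h1 := (Asymptotics.isLittleO_one_iff ℝ).2 h
    have h2 := h1.mul_isBigO (Asymptotics.isBigO_refl (fun y : ℝ => y - x) (𝓝 x))
    simpa [sq] using h2

end Derivative

/-! ### The monomer-dimer model on the induced subgraphs of a finite graph -/

section Finite

open Classical in
/-- The dimeric configurations whose dimers have both ends in `S`. -/
def configsIn {V : Type*} [Fintype V] (G : SimpleGraph V) (S : Finset V) :
    Finset (Finset (Sym2 V)) :=
  Finset.univ.filter fun D => IsDimerConfig G D ∧ ∀ e ∈ D, ∀ v ∈ e, v ∈ S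

/-- The partition function of the subgraph induced by `S`. -/
def partitionIn {V : Type*} [Fintype V] (G : SimpleGraph V) (S : Finset V) (x : ℝ) : ℝ :=
  ∑ D ∈ configsIn G S, x ^ (S.card - 2 * D.card)

variable {V : Type*} [Fintype V] {G : SimpleGraph V} {S : Finset V} {D : Finset (Sym2 V)}

lemma mem_configsIn : D ∈ configsIn G S ↔ IsDimerConfig G D ∧ ∀ e ∈ D, ∀ v ∈ e, v ∈ S := by
  simp [configsIn]

variable (G) in
lemma partitionIn_univ (x : ℝ) : partitionIn G Finset.univ x = partitionFunction G x := by
  rw [partitionIn, partitionFunction]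
  refine Finset.sum_congr ?_ fun D _ => by rw [Finset.card_univ]
  ext D
  simp [mem_configsIn]

open Classical in
/-- The vertices covered by the dimers. -/
def covered (D : Finset (Sym2 V)) : Finset V := D.biUnion Sym2.toFinset

omit [Fintype V] in
lemma mem_covered {v : V} : v ∈ covered D ↔ ∃ e ∈ D, v ∈ e := by
  simp [covered]

lemma covered_subset (h : D ∈ configsIn G S) : covered D ⊆ S := fun v hv => by
  obtain ⟨e, he, hve⟩ := mem_covered.1 hv
  exact (mem_configsIn.1 h).2 e he v hve

lemma card_covered (h : D ∈ configsIn G S) : (covered D).card = 2 * D.card := by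
  classical
  obtain ⟨⟨h1, h2⟩, -⟩ := mem_configsIn.1 h
  rw [covered, Finset.card_biUnion, Finset.sum_congr rfl (g := fun _ => 2), Finset.sum_const,
    smul_eq_mul, mul_comm]
  · exact fun e he => Sym2.card_toFinset_of_not_isDiag e (G.not_isDiag_of_mem_edgeSet (h1 e he))
  · intro e he f hf hef
    rw [Function.onFun, Finset.disjoint_left]
    exact fun v hv hv' => h2 e he f hf hef v ⟨Sym2.mem_toFinset.1 hv, Sym2.mem_toFinset.1 hv'⟩

lemma two_mul_card_le (h : D ∈ configsIn G S) : 2 * D.card ≤ S.card :=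
  card_covered h ▸ Finset.card_le_card (covered_subset h)

section Erase

variable [DecidableEq V]

lemma mem_configsIn_erase {v : V} :
    D ∈ configsIn G (S.erase v) ↔ D ∈ configsIn G S ∧ v ∉ covered D := by
  simp only [mem_configsIn, Finset.mem_erase, mem_covered, not_exists, not_and]
  constructor
  · rintro ⟨h1, h2⟩
    exact ⟨⟨h1, fun e he w hw => (h2 e he w hw).2⟩, fun e he hv => (h2 e he v hv).1 rfl⟩
  · rintro ⟨⟨h1, h2⟩, h3⟩
    refine ⟨h1, fun e he w hw => ⟨?_, h2 e he w hw⟩⟩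
    rintro rfl
    exact h3 e he hw

lemma insert_mem_configsIn {u v : V} (hv : v ∈ S) (hu : u ∈ S) (huv : G.Adj v u)
    (hD : D ∈ configsIn G ((S.erase v).erase u)) :
    s(v, u) ∉ D ∧ insert s(v, u) D ∈ configsIn G S := by
  obtain ⟨hD1, hu'⟩ := mem_configsIn_erase.1 hD
  obtain ⟨hD2, hv'⟩ := mem_configsIn_erase.1 hD1
  obtain ⟨⟨h1, h2⟩, h3⟩ := mem_configsIn.1 hD2
  rw [mem_covered] at hu' hv'
  push Not at hu' hv'
  refine ⟨fun h => hv' _ h (Sym2.mem_mk_left v u), mem_configsIn.2 ⟨⟨?_, ?_⟩, ?_⟩⟩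
  · intro e he
    rcases Finset.mem_insert.1 he with rfl | he
    exacts [huv, h1 e he]
  · intro e he f hf hef w hw
    rcases Finset.mem_insert.1 he with rfl | he' <;> rcases Finset.mem_insert.1 hf with rfl | hf'
    · exact hef rfl
    · rcases Sym2.mem_iff.1 hw.1 with rfl | rfl
      exacts [hv' f hf' hw.2, hu' f hf' hw.2]
    · rcases Sym2.mem_iff.1 hw.2 with rfl | rfl
      exacts [hv' e he' hw.1, hu' e he' hw.1]
    · exact h2 e he' f hf' hef w hw
  · intro e he w hw
    rcases Finset.mem_insert.1 he with rfl | he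
    · rcases Sym2.mem_iff.1 hw with rfl | rfl <;> assumption
    · exact h3 e he w hw

lemma erase_mem_configsIn {u v : V} (hD : D ∈ configsIn G S) (h : s(v, u) ∈ D) :
    D.erase s(v, u) ∈ configsIn G ((S.erase v).erase u) := by
  obtain ⟨⟨h1, h2⟩, h3⟩ := mem_configsIn.1 hD
  have hcov : ∀ w ∈ s(v, u), w ∉ covered (D.erase s(v, u)) := fun w hw hw' => by
    obtain ⟨e, he, hwe⟩ := mem_covered.1 hw'
    obtain ⟨he1, he2⟩ := Finset.mem_erase.1 he
    exact h2 e he2 _ h he1 w ⟨hwe, hw⟩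
  refine mem_configsIn_erase.2 ⟨mem_configsIn_erase.2 ⟨mem_configsIn.2 ⟨⟨?_, ?_⟩, ?_⟩,
    hcov v (Sym2.mem_mk_left v u)⟩, hcov u (Sym2.mem_mk_right v u)⟩
  · exact fun e he => h1 e (Finset.mem_of_mem_erase he)
  · exact fun e he f hf => h2 e (Finset.mem_of_mem_erase he) f (Finset.mem_of_mem_erase hf)
  · exact fun e he => h3 e (Finset.mem_of_mem_erase he)

open Classical in
/-- The expansion of the partition function at a vertex. -/
lemma partitionIn_eq {v : V} (hv : v ∈ S) (x : ℝ) :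
    partitionIn G S x = x * partitionIn G (S.erase v) x
      + ∑ u ∈ S.filter (G.Adj v), partitionIn G ((S.erase v).erase u) x := by
  have hdimer : ∀ u ∈ S.filter (G.Adj v), partitionIn G ((S.erase v).erase u) x
      = ∑ D ∈ configsIn G S, if s(v, u) ∈ D then x ^ (S.card - 2 * D.card) else 0 := by
    intro u hu
    obtain ⟨huS, huv⟩ := Finset.mem_filter.1 hu
    rw [← Finset.sum_filter, partitionIn]
    refine Finset.sum_nbij' (insert s(v, u)) (fun D => D.erase s(v, u)) ?_ ?_ ?_ ?_ ?_
    · exact fun D hD => Finset.mem_filter.2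
        ⟨(insert_mem_configsIn hv huS huv hD).2, Finset.mem_insert_self _ _⟩
    · exact fun D hD => erase_mem_configsIn (Finset.mem_filter.1 hD).1 (Finset.mem_filter.1 hD).2
    · exact fun D hD => Finset.erase_insert (insert_mem_configsIn hv huS huv hD).1
    · exact fun D hD => Finset.insert_erase (Finset.mem_filter.1 hD).2
    · intro D hD
      rw [Finset.card_insert_of_notMem (insert_mem_configsIn hv huS huv hD).1,
        Finset.card_erase_of_mem (Finset.mem_erase.2 ⟨huv.ne', huS⟩), Finset.card_erase_of_mem hv]
      congr 1
      omega
  have hmono : x * partitionIn G (S.erase v) x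
      = ∑ D ∈ configsIn G S, if v ∉ covered D then x ^ (S.card - 2 * D.card) else 0 := by
    rw [← Finset.sum_filter, partitionIn, Finset.mul_sum]
    refine Finset.sum_congr (by ext D; simp [mem_configsIn_erase]) fun D hD => ?_
    have h1 := two_mul_card_le (mem_configsIn_erase.2 (Finset.mem_filter.1 hD))
    have h2 := Finset.card_pos.2 ⟨v, hv⟩
    rw [Finset.card_erase_of_mem hv] at h1 ⊢
    rw [← pow_succ']
    congr 1
    omega
  rw [hmono, Finset.sum_congr rfl hdimer, Finset.sum_comm, ← Finset.sum_add_distrib]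
  refine Finset.sum_congr rfl fun D hD => ?_
  obtain ⟨⟨h1, h2⟩, h3⟩ := mem_configsIn.1 hD
  by_cases hvD : v ∈ covered D
  · obtain ⟨e, he, hve⟩ := mem_covered.1 hvD
    obtain ⟨u, rfl⟩ := Sym2.mem_iff_exists.1 hve
    have huS : u ∈ S := h3 _ he u (Sym2.mem_mk_right v u)
    rw [if_neg (not_not.2 hvD), Finset.sum_eq_single u, if_pos he, zero_add]
    · intro w _ hwu
      refine if_neg fun hw => ?_
      exact h2 _ he _ hw (fun h => hwu (Sym2.congr_right.1 h).symm) v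
        ⟨Sym2.mem_mk_left v u, Sym2.mem_mk_left v w⟩
    · exact fun hu => absurd (Finset.mem_filter.2 ⟨huS, h1 _ he⟩) hu
  · rw [if_pos hvD, Finset.sum_eq_zero, add_zero]
    exact fun u _ => if_neg fun h => hvD (mem_covered.2 ⟨_, h, Sym2.mem_mk_left v u⟩)

lemma hasDerivAt_partitionIn (G : SimpleGraph V) (S : Finset V) (x : ℝ) :
    HasDerivAt (partitionIn G S) (∑ v ∈ S, partitionIn G (S.erase v) x) x := by
  classical
  have h : HasDerivAt (partitionIn G S)
      (∑ D ∈ configsIn G S, ((S.card - 2 * D.card : ℕ) : ℝ) * x ^ (S.card - 2 * D.card - 1)) x :=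
    HasDerivAt.fun_sum fun D _ => hasDerivAt_pow _ x
  convert h using 1
  simp_rw [partitionIn]
  rw [Finset.sum_comm' (t' := configsIn G S) (s' := fun D => S \ covered D)]
  · refine Finset.sum_congr rfl fun D hD => ?_
    rw [Finset.sum_congr rfl (g := fun _ => x ^ (S.card - 2 * D.card - 1)), Finset.sum_const,
      nsmul_eq_mul, Finset.card_sdiff_of_subset (covered_subset hD), card_covered hD]
    intro v hv
    rw [Finset.card_erase_of_mem (Finset.mem_sdiff.1 hv).1]
    congr 1
    omega
  · intro v D
    rw [mem_configsIn_erase, Finset.mem_sdiff]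
    tauto

end Erase

variable (G) in
lemma partitionIn_pos {x : ℝ} (hx : 0 < x) (S : Finset V) : 0 < partitionIn G S x := by
  refine Finset.sum_pos (fun D _ => pow_pos hx _) ⟨∅, mem_configsIn.2 ?_⟩
  simp [IsDimerConfig]

open Classical in
/-- The message sent by the vertex `v` of the subgraph induced by `S`: the ratio of the partition
functions without and with `v`. -/
def msgIn (G : SimpleGraph V) (x : ℝ) (S : Finset V) (v : V) : ℝ :=
  partitionIn G (S.erase v) x / partitionIn G S x

lemma msgIn_nonneg {x : ℝ} (hx : 0 < x) (S : Finset V) (v : V) : 0 ≤ msgIn G x S v :=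
  div_nonneg (partitionIn_pos G hx _).le (partitionIn_pos G hx _).le

open Classical in
lemma msgIn_eq {x : ℝ} (hx : 0 < x) {v : V} (hv : v ∈ S) :
    msgIn G x S v = (x + ∑ u ∈ S.filter (G.Adj v), msgIn G x (S.erase v) u)⁻¹ := by
  have h := (partitionIn_pos G hx (S.erase v)).ne'
  rw [msgIn, partitionIn_eq hv, ← inv_div]
  congr 1
  simp_rw [msgIn]
  rw [← Finset.sum_div, add_div, mul_div_cancel_right₀ _ h]

lemma msgIn_le {x : ℝ} (hx : 0 < x) {v : V} (hv : v ∈ S) : msgIn G x S v ≤ x⁻¹ := by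
  rw [msgIn_eq hx hv]
  exact inv_anti₀ hx (le_add_of_nonneg_right (Finset.sum_nonneg fun u _ => msgIn_nonneg hx _ u))

lemma hasDerivAt_log_partitionIn {x : ℝ} (hx : 0 < x) (S : Finset V) :
    HasDerivAt (fun y => Real.log (partitionIn G S y)) (∑ v ∈ S, msgIn G x S v) x := by
  classical
  convert (hasDerivAt_partitionIn G S x).log (partitionIn_pos G hx S).ne' using 1
  rw [Finset.sum_div]
  refine Finset.sum_congr rfl fun v _ => ?_
  rw [msgIn]

open Classical in
lemma log_partitionIn_bounds {x : ℝ} (hx : 0 < x) (S : Finset V) :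
    S.card * Real.log x ≤ Real.log (partitionIn G S x) ∧
    Real.log (partitionIn G S x) ≤ S.card * Real.log x + ∑ v ∈ S, (G.degree v : ℝ) * (x ^ 2)⁻¹ := by
  induction S using Finset.induction_on with
  | empty =>
    have : partitionIn G ∅ x = 1 := by
      rw [partitionIn, Finset.sum_eq_single ∅]
      · simp
      · intro D hD hD0
        have := two_mul_card_le hD
        simp only [Finset.card_empty, nonpos_iff_eq_zero, mul_eq_zero, OfNat.ofNat_ne_zero,
          false_or, Finset.card_eq_zero] at this
        exact absurd this hD0
      · exact fun h => absurd (mem_configsIn.2 (by simp [IsDimerConfig])) h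
    simp [this]
  | insert v S hv ih =>
    have hZ := partitionIn_pos G hx S
    have hsum0 : 0 ≤ ∑ u ∈ (insert v S).filter (G.Adj v), msgIn G x S u :=
      Finset.sum_nonneg fun u _ => msgIn_nonneg hx _ u
    have hsum : ∑ u ∈ (insert v S).filter (G.Adj v), msgIn G x S u ≤ G.degree v * x⁻¹ := by
      have h1 : ∀ u ∈ (insert v S).filter (G.Adj v), msgIn G x S u ≤ x⁻¹ := by
        intro u hu
        obtain ⟨hu1, hu2⟩ := Finset.mem_filter.1 hu
        exact msgIn_le hx (Finset.mem_of_mem_insert_of_ne hu1 hu2.ne')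
      refine (Finset.sum_le_card_nsmul _ _ _ h1).trans ?_
      rw [nsmul_eq_mul]
      refine mul_le_mul_of_nonneg_right (Nat.cast_le.2 ?_) (inv_pos.2 hx).le
      rw [← G.card_neighborFinset_eq_degree]
      exact Finset.card_le_card fun u hu =>
        (G.mem_neighborFinset v u).2 (Finset.mem_filter.1 hu).2
    have hrec : partitionIn G (insert v S) x
        = partitionIn G S x * (x + ∑ u ∈ (insert v S).filter (G.Adj v), msgIn G x S u) := by
      rw [partitionIn_eq (Finset.mem_insert_self v S), Finset.erase_insert hv, mul_add, mul_comm,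
        Finset.mul_sum]
      congr 1
      refine Finset.sum_congr rfl fun u _ => ?_
      rw [msgIn, mul_div_cancel₀ _ hZ.ne']
    set s := ∑ u ∈ (insert v S).filter (G.Adj v), msgIn G x S u with hs
    have hlog : Real.log (x + s) ≤ Real.log x + G.degree v * (x ^ 2)⁻¹ := by
      have h1 := Real.log_le_sub_one_of_pos (show 0 < (x + s) / x by positivity)
      rw [Real.log_div (by positivity) hx.ne'] at h1
      have h2 : (x + s) / x - 1 = s * x⁻¹ := by field_simp; ring
      have h3 : s * x⁻¹ ≤ G.degree v * (x ^ 2)⁻¹ := by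
        rw [sq, mul_inv, ← mul_assoc]
        exact mul_le_mul_of_nonneg_right hsum (inv_pos.2 hx).le
      linarith
    have hlog' : Real.log x ≤ Real.log (x + s) := Real.log_le_log hx (by linarith)
    rw [hrec, Real.log_mul hZ.ne' (by positivity), Finset.card_insert_of_notMem hv,
      Finset.sum_insert hv]
    push_cast
    constructor <;> linarith [ih.1, ih.2]

end Finite

/-! ### Messages from a neighbourhood of a vertex -/

/-- The message sent by `v` in the subgraph induced by `S`, computed from the self-avoiding walks
of length less than `r`. -/
def graphMsg (x : ℝ) {V : Type*} (G : SimpleGraph V) : ℕ → Set V → V → ℝ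
  | 0, _, _ => 0
  | r + 1, S, v => (x + ∑ᶠ u ∈ {u | u ∈ S ∧ G.Adj v u}, graphMsg x G r (S \ {v}) u)⁻¹

section GraphMsg

variable {x : ℝ} {V W : Type*} {G : SimpleGraph V} {H : SimpleGraph W}

lemma graphMsg_nonneg (hx : 0 < x) (r : ℕ) (S : Set V) (v : V) : 0 ≤ graphMsg x G r S v := by
  induction r generalizing S v with
  | zero => exact le_rfl
  | succ r ih =>
    exact inv_nonneg.2 (add_nonneg hx.le (finsum_nonneg fun u => finsum_nonneg fun _ => ih _ u))

lemma graphMsg_le (hx : 0 < x) (r : ℕ) (S : Set V) (v : V) : graphMsg x G r S v ≤ x⁻¹ := by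
  cases r with
  | zero => exact (inv_pos.2 hx).le
  | succ r =>
    exact inv_anti₀ hx (le_add_of_nonneg_right
      (finsum_nonneg fun u => finsum_nonneg fun _ => graphMsg_nonneg hx r _ u))

open Classical in
lemma graphMsg_succ_coe [Fintype V] (r : ℕ) (S : Finset V) (v : V) :
    graphMsg x G (r + 1) S v
      = (x + ∑ u ∈ S.filter (G.Adj v), graphMsg x G r (S.erase v : Finset V) u)⁻¹ := by
  have h : {u | u ∈ (S : Set V) ∧ G.Adj v u} = (S.filter (G.Adj v) : Finset V) := by
    ext u; simp
  rw [graphMsg, h, finsum_mem_coe_finset, Finset.coe_erase]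

lemma graphMsg_le_msgIn_le [Fintype V] (hx : 0 < x) (r : ℕ) {S : Finset V} {v : V} (hv : v ∈ S) :
    graphMsg x G (2 * r) S v ≤ msgIn G x S v ∧ msgIn G x S v ≤ graphMsg x G (2 * r + 1) S v := by
  classical
  have hmem : ∀ {S : Finset V} {v : V} {u}, u ∈ S.filter (G.Adj v) → u ∈ S.erase v :=
    fun {S v u} hu => Finset.mem_erase.2
      ⟨(Finset.mem_filter.1 hu).2.ne', (Finset.mem_filter.1 hu).1⟩
  have hpos : ∀ s (S : Finset V) v, 0 < x + ∑ u ∈ S.filter (G.Adj v),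
      graphMsg x G s (S.erase v : Finset V) u := fun s S v =>
    add_pos_of_pos_of_nonneg hx (Finset.sum_nonneg fun u _ => graphMsg_nonneg hx s _ u)
  have hpos' : ∀ (S : Finset V) v, 0 < x + ∑ u ∈ S.filter (G.Adj v), msgIn G x (S.erase v) u :=
    fun S v => add_pos_of_pos_of_nonneg hx (Finset.sum_nonneg fun u _ => msgIn_nonneg hx _ u)
  have upper : ∀ s, (∀ (S : Finset V) (v), v ∈ S → graphMsg x G s S v ≤ msgIn G x S v) →
      ∀ (S : Finset V) (v), v ∈ S → msgIn G x S v ≤ graphMsg x G (s + 1) S v := by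
    intro s h S v hv
    rw [msgIn_eq hx hv, graphMsg_succ_coe]
    exact inv_anti₀ (hpos s S v) (add_le_add le_rfl (Finset.sum_le_sum fun u hu => h _ u (hmem hu)))
  have lower : ∀ s, (∀ (S : Finset V) (v), v ∈ S → msgIn G x S v ≤ graphMsg x G s S v) →
      ∀ (S : Finset V) (v), v ∈ S → graphMsg x G (s + 1) S v ≤ msgIn G x S v := by
    intro s h S v hv
    rw [msgIn_eq hx hv, graphMsg_succ_coe]
    exact inv_anti₀ (hpos' S v) (add_le_add le_rfl (Finset.sum_le_sum fun u hu => h _ u (hmem hu)))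
  have key : ∀ (S : Finset V) (v), v ∈ S → graphMsg x G (2 * r) S v ≤ msgIn G x S v := by
    induction r with
    | zero => exact fun S v _ => msgIn_nonneg hx S v
    | succ r ih => exact lower _ (upper _ ih)
  exact ⟨key S v hv, upper _ key S v hv⟩

lemma graphMsg_iso (e : G ≃g H) (r : ℕ) (S : Set W) (v : V) :
    graphMsg x G r (e ⁻¹' S) v = graphMsg x H r S (e v) := by
  induction r generalizing S v with
  | zero => rfl
  | succ r ih =>
    simp only [graphMsg]
    congr 2
    refine finsum_mem_eq_of_bijOn e ⟨?_, e.injective.injOn, ?_⟩ ?_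
    · exact fun u hu => ⟨hu.1, e.map_adj_iff.2 hu.2⟩
    · intro w hw
      refine ⟨e.symm w, ⟨?_, ?_⟩, e.apply_symm_apply w⟩
      · simpa using hw.1
      · rw [← e.map_adj_iff, e.apply_symm_apply]; exact hw.2
    · intro u _
      rw [← ih]
      congr 1
      ext w
      simp

lemma graphMsg_induce (B : Set V) (r : ℕ) (S : Set V) (v : B)
    (hB : ∀ u, G.edist v u ≤ r → u ∈ B) :
    graphMsg x (G.induce B) r (Subtype.val ⁻¹' S) v = graphMsg x G r S v := by
  induction r generalizing S v with
  | zero => rfl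
  | succ r ih =>
    simp only [graphMsg]
    congr 2
    refine finsum_mem_eq_of_bijOn Subtype.val ⟨?_, Subtype.val_injective.injOn, ?_⟩ ?_
    · exact fun u hu => ⟨hu.1, hu.2⟩
    · intro w hw
      have h1 : G.edist v w ≤ 1 := SimpleGraph.edist_le_one_iff_adj_or_eq.2 (Or.inl hw.2)
      refine ⟨⟨w, hB w (h1.trans ?_)⟩, ⟨hw.1, hw.2⟩, rfl⟩
      exact_mod_cast Nat.le_add_left 1 r
    · intro u hu
      have h1 : G.edist v u ≤ 1 := SimpleGraph.edist_le_one_iff_adj_or_eq.2 (Or.inl hu.2)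
      rw [← ih (S \ {v.1}) u fun w hw => hB w ?_]
      · congr 1
        ext w
        simp [Subtype.ext_iff]
      · refine SimpleGraph.edist_triangle.trans ((add_le_add h1 hw).trans ?_)
        rw [add_comm]
        exact_mod_cast le_rfl

lemma graphMsg_of_rootedIso {o : V} {o' : W} (h : RootedIso G o H o') (r : ℕ) :
    graphMsg x G r Set.univ o = graphMsg x H r Set.univ o' := by
  obtain ⟨e, rfl⟩ := h
  exact graphMsg_iso e r Set.univ o

lemma graphMsg_of_ballIso {o : V} {r : ℕ} {t : W} (h : BallIso G o r H t) :
    graphMsg x G r Set.univ o = graphMsg x H r Set.univ t := by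
  rw [← graphMsg_of_rootedIso h]
  exact (graphMsg_induce (ballSet G o r) r Set.univ ⟨o, mem_ballSet_self G o r⟩
    fun u hu => hu).symm

lemma RootedIso.symm {o : V} {o' : W} (h : RootedIso G o H o') : RootedIso H o' G o := by
  obtain ⟨e, rfl⟩ := h
  exact ⟨e.symm, e.symm_apply_apply o⟩

lemma RootedIso.trans {U : Type*} {F : SimpleGraph U} {o : V} {o' : W} {o'' : U}
    (h : RootedIso G o H o') (h' : RootedIso H o' F o'') : RootedIso G o F o'' := by
  obtain ⟨e, rfl⟩ := h
  obtain ⟨e', rfl⟩ := h'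
  exact ⟨e.trans e', rfl⟩

end GraphMsg

/-! ### Truncated family trees -/

section FamilyTree

variable {x : ℝ} (K : List ℕ → ℕ)

lemma graphMsg_familyTree (r : ℕ) (u : {u : List ℕ // IsNode K u}) (S : Set {u : List ℕ // IsNode K u})
    (hpar : ∀ i (w : {u : List ℕ // IsNode K u}), u.1 = i :: w.1 → w ∉ S)
    (hdesc : ∀ w : {u : List ℕ // IsNode K u}, u.1 <:+ w.1 → w ≠ u → w ∈ S) :
    graphMsg x (familyTree K) r S u = treeMsg x r fun w => K (w ++ u.1) := by
  induction r generalizing u S with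
  | zero => rfl
  | succ r ih =>
    simp only [graphMsg, treeMsg, List.nil_append]
    congr 2
    rw [← finsum_mem_coe_finset]
    have hch : ∀ w ∈ {w | w ∈ S ∧ (familyTree K).Adj u w}, ∃ i, w.1 = i :: u.1 := by
      rintro w ⟨hw, ⟨i, hi⟩ | ⟨i, hi⟩⟩
      · exact absurd hw (hpar i w hi)
      · exact ⟨i, hi⟩
    refine finsum_mem_eq_of_bijOn (fun w => w.1.headI) ⟨?_, ?_, ?_⟩ ?_
    · intro w hw
      obtain ⟨i, hi⟩ := hch w hw
      have h := w.2
      rw [hi] at h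
      simpa [hi] using h.2
    · intro w hw w' hw' h
      obtain ⟨i, hi⟩ := hch w hw
      obtain ⟨j, hj⟩ := hch w' hw'
      simp only [hi, hj, List.headI_cons] at h
      exact Subtype.ext (by rw [hi, hj, h])
    · intro i hi
      refine ⟨⟨i :: u.1, u.2, by simpa using hi⟩, ⟨hdesc _ (List.suffix_cons i u.1) ?_,
        Or.inr ⟨i, rfl⟩⟩, rfl⟩
      exact fun h => by simpa using congrArg (fun w => w.1.length) h
    · intro w hw
      obtain ⟨i, hi⟩ := hch w hw
      rw [ih w (S \ {u})]
      · congr 1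
        funext v
        simp [shift, hi]
      · intro j v hj hv
        rw [hi, List.cons.injEq] at hj
        exact hv.2 (Subtype.ext hj.2.symm)
      · intro v hv hvw
        have h1 : u.1 <:+ w.1 := hi ▸ List.suffix_cons i u.1
        have h2 : v ≠ u := by
          rintro rfl
          have := hv.length_le
          simp [hi] at this
        exact ⟨hdesc v (h1.trans hv) h2, h2⟩

/-- The family tree truncated after the first `r` generations. -/
abbrev truncTree (r : ℕ) : SimpleGraph (firstGenerations K r) :=
  (familyTree K).induce (firstGenerations K r)

/-- The root of the truncated family tree. -/
abbrev truncRoot (r : ℕ) : firstGenerations K r := ⟨⟨[], trivial⟩, Nat.zero_le r⟩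

lemma length_le_of_walk {u v : {u : List ℕ // IsNode K u}} (p : (familyTree K).Walk u v) :
    v.1.length ≤ u.1.length + p.length := by
  induction p with
  | nil => simp
  | cons h p ih =>
    rw [SimpleGraph.Walk.length_cons]
    rcases h with ⟨i, hi⟩ | ⟨i, hi⟩ <;> simp only [hi, List.length_cons] at * <;> omega

lemma graphMsg_truncTree (r : ℕ) :
    graphMsg x (truncTree K r) r Set.univ (truncRoot K r) = treeMsg x r K := by
  have h1 := graphMsg_induce (x := x) (G := familyTree K) (firstGenerations K r) r Set.univ
    (truncRoot K r) fun u hu => ?_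
  · refine h1.trans ((graphMsg_familyTree K r _ Set.univ ?_ fun _ _ _ => trivial).trans ?_)
    · intro i w h
      simp at h
    · simp
  · have hne : (familyTree K).edist (truncRoot K r).1 u ≠ ⊤ :=
      ne_top_of_le_ne_top (ENat.natCast_ne_top r) hu
    obtain ⟨p, hp⟩ := SimpleGraph.exists_walk_of_edist_ne_top hne
    rw [← hp] at hu
    have h2 := length_le_of_walk K p
    have h3 : p.length ≤ r := by exact_mod_cast hu
    simp only [List.length_nil, zero_add] at h2
    exact h2.trans h3

lemma finite_nodes (r : ℕ) : {u : List ℕ | IsNode K u ∧ u.length ≤ r}.Finite := by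
  induction r with
  | zero =>
    refine (Set.finite_singleton []).subset fun u hu => ?_
    simpa using hu.2
  | succ r ih =>
    refine ((ih.biUnion fun u _ => (Finset.range (K u)).finite_toSet.image (· :: u)).union
      (Set.finite_singleton [])).subset ?_
    rintro (_ | ⟨i, u⟩) ⟨h1, h2⟩
    · exact Or.inr rfl
    · refine Or.inl (Set.mem_biUnion (x := u) ⟨h1.1, by simpa using h2⟩ ⟨i, ?_, rfl⟩)
      simpa using h1.2

instance (r : ℕ) : Finite (firstGenerations K r) := by
  have := (finite_nodes K r).to_subtype
  refine Finite.of_injective (β := {u : List ℕ | IsNode K u ∧ u.length ≤ r})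
    (fun u => ⟨u.1.1, u.1.2, u.2⟩) fun u v h => ?_
  exact Subtype.ext (Subtype.ext (congrArg (fun w => w.1) h))

lemma exists_walk_truncTree (r : ℕ) (u : firstGenerations K r) :
    ∃ p : (truncTree K r).Walk (truncRoot K r) u, p.length = u.1.1.length := by
  obtain ⟨⟨u, hu⟩, hr⟩ := u
  induction u with
  | nil => exact ⟨.nil, rfl⟩
  | cons i u ih =>
    have hr' : u.length ≤ r := (Nat.le_succ _).trans hr
    obtain ⟨p, hp⟩ := ih hu.1 hr'
    have hadj : (truncTree K r).Adj ⟨⟨u, hu.1⟩, hr'⟩ ⟨⟨i :: u, hu⟩, hr⟩ := Or.inr ⟨i, rfl⟩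
    exact ⟨p.concat hadj, by simp [hp]⟩

lemma isTree_truncTree (r : ℕ) : (truncTree K r).IsTree := by
  have hconn : (truncTree K r).Connected := by
    have hroot : ∀ u, (truncTree K r).Reachable (truncRoot K r) u := fun u =>
      (exists_walk_truncTree K r u).choose.reachable
    have : Nonempty (firstGenerations K r) := ⟨truncRoot K r⟩
    exact ⟨fun u v => (hroot u).symm.trans (hroot v)⟩
  rw [SimpleGraph.isTree_iff_connected_and_card]
  refine ⟨hconn, le_antisymm ?_ hconn.card_vert_le_card_edgeSet_add_one⟩
  have hle : Nat.card (truncTree K r).edgeSet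
      ≤ Nat.card {u : firstGenerations K r // u ≠ truncRoot K r} := by
    have hpar : ∀ u : {u : firstGenerations K r // u ≠ truncRoot K r},
        ∃ e : (truncTree K r).edgeSet, ∀ w : firstGenerations K r, ∀ i, u.1.1.1 = i :: w.1.1 →
          e.1 = s(u.1, w) := by
      rintro ⟨⟨⟨u, hu⟩, hr⟩, h0⟩
      rcases u with _ | ⟨i, u⟩
      · exact absurd rfl h0
      · have hr' : u.length ≤ r := (Nat.le_succ _).trans hr
        have hadj : (truncTree K r).Adj ⟨⟨i :: u, hu⟩, hr⟩ ⟨⟨u, hu.1⟩, hr'⟩ := Or.inl ⟨i, rfl⟩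
        refine ⟨⟨s(_, _), hadj⟩, fun w j hw => ?_⟩
        rw [List.cons.injEq] at hw
        have : w = ⟨⟨u, hu.1⟩, hr'⟩ := Subtype.ext (Subtype.ext hw.2.symm)
        rw [this]
    choose f hf using hpar
    refine Nat.card_le_card_of_surjective f ?_
    rintro ⟨e, he⟩
    induction e using Sym2.ind with
    | _ u v =>
      rcases he with ⟨i, hi⟩ | ⟨i, hi⟩
      · refine ⟨⟨u, fun h => ?_⟩, Subtype.ext (hf _ v i hi)⟩
        rw [h] at hi
        simp at hi
      · refine ⟨⟨v, fun h => ?_⟩, Subtype.ext ((hf _ u i hi).trans Sym2.eq_swap)⟩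
        rw [h] at hi
        simp at hi
  have hcard := Finite.card_subtype_lt (p := fun u => u ≠ truncRoot K r) (x := truncRoot K r)
    (fun h => h rfl)
  omega

lemma exists_rootedIso_truncTree (r : ℕ) : ∃ (m : ℕ) (T : SimpleGraph (Fin m)) (t : Fin m),
    RootedIso (truncTree K r) (truncRoot K r) T t := by
  obtain ⟨m, ⟨e⟩⟩ := Finite.exists_equiv_fin (firstGenerations K r)
  exact ⟨m, _, _, SimpleGraph.Iso.map e (truncTree K r), rfl⟩

variable {K} in
lemma isTree_and_dist_le_of_rootedIso {W : Type*} {T : SimpleGraph W} {t : W} {r : ℕ}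
    (h : RootedIso (truncTree K r) (truncRoot K r) T t) : T.IsTree ∧ ∀ v, T.dist t v ≤ r := by
  obtain ⟨e, rfl⟩ := h
  refine ⟨e.isTree_iff.1 (isTree_truncTree K r), fun v => ?_⟩
  obtain ⟨u, rfl⟩ := e.surjective v
  obtain ⟨p, hp⟩ := exists_walk_truncTree K r u
  refine (SimpleGraph.dist_le (p.map e.toHom)).trans ?_
  rw [SimpleGraph.Walk.length_map, hp]
  exact u.2

/-- The nodes of the first `r` generations. -/
def nodes (r : ℕ) : Finset (List ℕ) := (finite_nodes K r).toFinset

variable {K} in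
lemma rootedIso_of_nodes_eq {K' : List ℕ → ℕ} {r : ℕ} (h : nodes K r = nodes K' r) :
    RootedIso (truncTree K r) (truncRoot K r) (truncTree K' r) (truncRoot K' r) := by
  have hiff : ∀ u : List ℕ, (IsNode K u ∧ u.length ≤ r) ↔ (IsNode K' u ∧ u.length ≤ r) := by
    intro u
    have := congrArg (u ∈ ·) h
    simpa [nodes] using this
  refine ⟨⟨⟨fun u => ⟨⟨u.1.1, ((hiff _).1 ⟨u.1.2, u.2⟩).1⟩, u.2⟩,
    fun u => ⟨⟨u.1.1, ((hiff _).2 ⟨u.1.2, u.2⟩).1⟩, u.2⟩, fun _ => rfl, fun _ => rfl⟩, ?_⟩, rfl⟩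
  exact Iff.rfl

lemma measurableSet_isNode (u : List ℕ) : MeasurableSet {K : List ℕ → ℕ | IsNode K u} := by
  induction u with
  | nil => simp [IsNode]
  | cons i u ih =>
    exact ih.inter (measurableSet_lt measurable_const (measurable_pi_apply u))

lemma measurableSet_nodes_eq (r : ℕ) (F : Finset (List ℕ)) :
    MeasurableSet {K : List ℕ → ℕ | nodes K r = F} := by
  have e : {K : List ℕ → ℕ | nodes K r = F}
      = ⋂ u : List ℕ, {K | (IsNode K u ∧ u.length ≤ r) ↔ u ∈ F} := by
    ext K
    simp [nodes, Finset.ext_iff]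
  rw [e]
  refine MeasurableSet.iInter fun u => ?_
  by_cases h1 : u.length ≤ r <;> by_cases h2 : u ∈ F
  · simpa [h1, h2] using measurableSet_isNode u
  · have e : {K | (IsNode K u ∧ u.length ≤ r) ↔ u ∈ F} = {K | IsNode K u}ᶜ := by
      ext K
      simp [h1, h2]
    rw [e]
    exact (measurableSet_isNode u).compl
  · simp [h1, h2]
  · simp [h1, h2]

lemma measurableSet_of_nodes {r : ℕ} {A : Set (List ℕ → ℕ)}
    (hA : ∀ K K', nodes K r = nodes K' r → K ∈ A → K' ∈ A) : MeasurableSet A := by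
  have e : A = ⋃ F ∈ (fun K => nodes K r) '' A, {K | nodes K r = F} := by
    ext K
    simp only [Set.mem_iUnion, Set.mem_image]
    constructor
    · exact fun h => ⟨_, ⟨K, h, rfl⟩, rfl⟩
    · rintro ⟨F, ⟨K', h, rfl⟩, hK⟩
      exact hA K' K hK.symm h
  rw [e]
  exact MeasurableSet.biUnion (Set.to_countable _) fun F _ => measurableSet_nodes_eq r F

end FamilyTree

/-! ### Averages of local functions -/

/-- If frequencies converge to a probability distribution, so do the averages of bounded
functions. -/
lemma tendsto_average_of_tendsto_freq {ι : Type*} {p : ι → ℝ} {f : ℕ → ι → ℝ} {a : ι → ℝ}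
    {A : ℕ → ℝ} {B : ℝ} (hB : 0 ≤ B) (hp0 : ∀ i, 0 ≤ p i) (hp : HasSum p 1)
    (hf : ∀ i, Tendsto (fun n => f n i) atTop (𝓝 (p i))) (ha : ∀ i, |a i| ≤ B)
    (hA : ∀ᶠ n in atTop, ∀ s : Finset ι,
      |A n - ∑ i ∈ s, a i * f n i| ≤ B * (1 - ∑ i ∈ s, f n i)) :
    Tendsto A atTop (𝓝 (∑' i, p i * a i)) := by
  have hsum : Summable fun i => p i * a i := by
    refine Summable.of_norm_bounded (hp.summable.mul_right B) fun i => ?_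
    rw [Real.norm_eq_abs, abs_mul, abs_of_nonneg (hp0 i)]
    exact mul_le_mul_of_nonneg_left (ha i) (hp0 i)
  have hpart : ∀ s : Finset ι, |∑' i, p i * a i - ∑ i ∈ s, p i * a i|
      ≤ B * (1 - ∑ i ∈ s, p i) := by
    intro s
    have h1 : HasSum (fun i : {i // i ∉ s} => p i * a i)
        (∑' i, p i * a i - ∑ i ∈ s, p i * a i) := by
      rw [Finset.hasSum_compl_iff (f := fun i => p i * a i)]
      simpa using hsum.hasSum
    have h2 : HasSum (fun i : {i // i ∉ s} => p i * B) ((1 - ∑ i ∈ s, p i) * B) := by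
      refine HasSum.mul_right B ?_
      rw [Finset.hasSum_compl_iff (f := p)]
      simpa using hp
    rw [mul_comm, ← Real.norm_eq_abs, ← h1.tsum_eq]
    refine tsum_of_norm_bounded h2 fun i => ?_
    rw [Real.norm_eq_abs, abs_mul, abs_of_nonneg (hp0 i)]
    exact mul_le_mul_of_nonneg_left (ha i) (hp0 i)
  rw [Metric.tendsto_atTop']
  intro ε hε
  have hδ : 0 < ε / (2 * (2 * B + 1)) := by positivity
  obtain ⟨s, hs⟩ := ((tendsto_order.1 hp).1 (1 - ε / (2 * (2 * B + 1))) (by linarith)).exists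
  have hlim : Tendsto (fun n => B * (1 - ∑ i ∈ s, f n i)
      + |∑ i ∈ s, a i * f n i - ∑ i ∈ s, p i * a i| + B * (1 - ∑ i ∈ s, p i)) atTop
      (𝓝 (B * (1 - ∑ i ∈ s, p i) + |∑ i ∈ s, a i * p i - ∑ i ∈ s, p i * a i|
        + B * (1 - ∑ i ∈ s, p i))) :=
    (((tendsto_const_nhds.sub (tendsto_finsetSum s fun i _ => hf i)).const_mul B).add
      ((tendsto_finsetSum s fun i _ => (hf i).const_mul (a i)).sub_const _).abs).add_const _
  have hz : |∑ i ∈ s, a i * p i - ∑ i ∈ s, p i * a i| = 0 := by simp [mul_comm]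
  have hlt : B * (1 - ∑ i ∈ s, p i) + |∑ i ∈ s, a i * p i - ∑ i ∈ s, p i * a i|
        + B * (1 - ∑ i ∈ s, p i) < ε := by
    rw [hz]
    have h1 : (2 * B + 1) * (ε / (2 * (2 * B + 1))) = ε / 2 := by field_simp
    have h2 : B * (1 - ∑ i ∈ s, p i) ≤ B * (ε / (2 * (2 * B + 1))) :=
      mul_le_mul_of_nonneg_left (by linarith) hB
    nlinarith
  obtain ⟨N, hN⟩ := eventually_atTop.1 (hA.and ((tendsto_order.1 hlim).2 ε hlt))
  refine ⟨N, fun n hn => ?_⟩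
  obtain ⟨h1, h2⟩ := hN n hn.le
  refine lt_of_le_of_lt ?_ h2
  rw [Real.dist_eq]
  have h3 := hpart s
  rw [abs_sub_comm] at h3
  calc |A n - ∑' i, p i * a i|
      = |(A n - ∑ i ∈ s, a i * f n i) + (∑ i ∈ s, a i * f n i - ∑ i ∈ s, p i * a i)
        + (∑ i ∈ s, p i * a i - ∑' i, p i * a i)| := by ring_nf
    _ ≤ _ := (abs_add_three _ _ _).trans (add_le_add (add_le_add (h1 s) le_rfl) h3)

/-- Finite rooted graphs up to isomorphism. -/
instance rootedSetoid : Setoid (Σ m : ℕ, SimpleGraph (Fin m) × Fin m) where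
  r T T' := RootedIso T.2.1 T.2.2 T'.2.1 T'.2.2
  iseqv := ⟨fun _ => ⟨SimpleGraph.Iso.refl, rfl⟩, RootedIso.symm, RootedIso.trans⟩

/-- Isomorphism classes of finite rooted trees with at most `r` generations. -/
def TreeClass (r : ℕ) : Type :=
  {c : Quotient rootedSetoid // c.out.2.1.IsTree ∧ ∀ v, c.out.2.1.dist c.out.2.2 v ≤ r}

namespace TreeClass

variable {r : ℕ}

/-- The size of a representative. -/
abbrev size (c : TreeClass r) : ℕ := c.1.out.1

/-- A representative. -/
abbrev tree (c : TreeClass r) : SimpleGraph (Fin c.size) := c.1.out.2.1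

/-- The root of the representative. -/
abbrev root (c : TreeClass r) : Fin c.size := c.1.out.2.2

instance : Countable (TreeClass r) := by
  unfold TreeClass
  have : ∀ m : ℕ, Countable (SimpleGraph (Fin m) × Fin m) := fun m => Finite.to_countable
  infer_instance

lemma eq_of_rootedIso {V : Type*} {G : SimpleGraph V} {o : V} {c c' : TreeClass r}
    (h : RootedIso G o c.tree c.root) (h' : RootedIso G o c'.tree c'.root) : c = c' := by
  refine Subtype.ext ?_
  rw [← Quotient.out_eq c.1, ← Quotient.out_eq c'.1]
  exact Quotient.sound (h.symm.trans h')

lemma exists_rootedIso (K : List ℕ → ℕ) (r : ℕ) :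
    ∃ c : TreeClass r, RootedIso (truncTree K r) (truncRoot K r) c.tree c.root := by
  obtain ⟨m, T, t, h⟩ := exists_rootedIso_truncTree K r
  have h1 : RootedIso (truncTree K r) (truncRoot K r)
      (Quotient.mk rootedSetoid ⟨m, T, t⟩).out.2.1 (Quotient.mk rootedSetoid ⟨m, T, t⟩).out.2.2 :=
    h.trans (Setoid.symm (Quotient.mk_out (s := rootedSetoid) ⟨m, T, t⟩))
  exact ⟨⟨_, isTree_and_dist_le_of_rootedIso h1⟩, h1⟩

/-- The class of the truncated family tree. -/
def ofFamily (r : ℕ) (K : List ℕ → ℕ) : TreeClass r := (exists_rootedIso K r).choose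

lemma ofFamily_spec (r : ℕ) (K : List ℕ → ℕ) :
    RootedIso (truncTree K r) (truncRoot K r) (ofFamily r K).tree (ofFamily r K).root :=
  (exists_rootedIso K r).choose_spec

instance : MeasurableSpace (TreeClass r) := ⊤

lemma preimage_ofFamily (c : TreeClass r) : ofFamily r ⁻¹' {c}
    = {K | RootedIso (truncTree K r) (truncRoot K r) c.tree c.root} := by
  ext K
  constructor
  · rintro rfl
    exact ofFamily_spec r K
  · exact fun h => eq_of_rootedIso (ofFamily_spec r K) h

lemma measurable_ofFamily (r : ℕ) : Measurable (ofFamily r) := by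
  refine measurable_to_countable' fun c => ?_
  rw [preimage_ofFamily]
  exact measurableSet_of_nodes fun K K' h hK => (rootedIso_of_nodes_eq h).symm.trans hK

end TreeClass

lemma gwProb_eq (P ρ : PMF ℕ) {r : ℕ} (c : TreeClass r) :
    gwProb P ρ r c.tree c.root
      = ((offspringLaw P ρ).map (TreeClass.ofFamily r)).real {c} := by
  rw [map_measureReal_apply (TreeClass.measurable_ofFamily r) (measurableSet_singleton c),
    TreeClass.preimage_ofFamily]
  rfl

lemma integral_eq_tsum_gwProb (P ρ : PMF ℕ) {r : ℕ} {a : TreeClass r → ℝ} {B : ℝ}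
    (ha : ∀ c, |a c| ≤ B) :
    ∫ K, a (TreeClass.ofFamily r K) ∂offspringLaw P ρ
      = ∑' c : TreeClass r, gwProb P ρ r c.tree c.root * a c := by
  have : IsProbabilityMeasure ((offspringLaw P ρ).map (TreeClass.ofFamily r)) :=
    Measure.isProbabilityMeasure_map (TreeClass.measurable_ofFamily r).aemeasurable
  have hm : Measurable a := measurable_from_top
  rw [← integral_map (TreeClass.measurable_ofFamily r).aemeasurable hm.aestronglyMeasurable,
    integral_countable (Integrable.of_bound hm.aestronglyMeasurable B (Eventually.of_forall ha))]
  simp_rw [gwProb_eq, smul_eq_mul]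

lemma hasSum_gwProb (P ρ : PMF ℕ) (r : ℕ) :
    HasSum (fun c : TreeClass r => gwProb P ρ r c.tree c.root) 1 := by
  have h := integral_eq_tsum_gwProb P ρ (r := r) (a := fun _ => 1) (B := 1) (by simp)
  simp only [integral_const, probReal_univ, smul_eq_mul, mul_one] at h
  have hs : Summable fun c : TreeClass r => gwProb P ρ r c.tree c.root := by
    by_contra hs
    rw [tsum_eq_zero_of_not_summable hs] at h
    exact one_ne_zero h
  rw [h]
  exact hs.hasSum

open Classical in
/-- The averages of the messages from the neighbourhoods of the vertices converge to the expected
message of the Galton-Watson tree. -/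
lemma tendsto_average_graphMsg {V : ℕ → Type*} [∀ n, Fintype (V n)] {G : ∀ n, SimpleGraph (V n)}
    {P ρ : PMF ℕ} {r : ℕ}
    (h : ∀ c : TreeClass r, Tendsto
      (fun n => (∑ v : V n, if BallIso (G n) v r c.tree c.root then (1 : ℝ) else 0)
        / (Fintype.card (V n) : ℝ)) atTop (𝓝 (gwProb P ρ r c.tree c.root)))
    (hcard : ∀ᶠ n in atTop, 0 < Fintype.card (V n)) {x : ℝ} (hx : 0 < x) :
    Tendsto (fun n => (∑ v : V n, graphMsg x (G n) r Set.univ v) / (Fintype.card (V n) : ℝ)) atTop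
      (𝓝 (∫ K, treeMsg x r K ∂offspringLaw P ρ)) := by
  have hint : ∫ K, treeMsg x r K ∂offspringLaw P ρ
      = ∑' c : TreeClass r, gwProb P ρ r c.tree c.root * graphMsg x c.tree r Set.univ c.root := by
    rw [← integral_eq_tsum_gwProb P ρ (B := x⁻¹) fun c => ?_]
    · refine integral_congr_ae (Eventually.of_forall fun K => ?_)
      exact (graphMsg_truncTree K r).symm.trans
        (graphMsg_of_rootedIso (TreeClass.ofFamily_spec r K) r)
    · rw [abs_of_nonneg (graphMsg_nonneg hx r _ _)]
      exact graphMsg_le hx r _ _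
  rw [hint]
  refine tendsto_average_of_tendsto_freq (B := x⁻¹) (inv_pos.2 hx).le
    (fun c => measureReal_nonneg) (hasSum_gwProb P ρ r) h (fun c => ?_) ?_
  · rw [abs_of_nonneg (graphMsg_nonneg hx r _ _)]
    exact graphMsg_le hx r _ _
  filter_upwards [hcard] with n hn s
  have hN : (0 : ℝ) < Fintype.card (V n) := Nat.cast_pos.2 hn
  have hv : ∀ v : V n, |graphMsg x (G n) r Set.univ v - ∑ c ∈ s,
      graphMsg x c.tree r Set.univ c.root * (if BallIso (G n) v r c.tree c.root then (1 : ℝ) else 0)|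
      ≤ x⁻¹ * (1 - ∑ c ∈ s, if BallIso (G n) v r c.tree c.root then (1 : ℝ) else 0) := by
    intro v
    by_cases hex : ∃ c ∈ s, BallIso (G n) v r c.tree c.root
    · obtain ⟨c, hcs, hc⟩ := hex
      have hne : ∀ c' ∈ s, c' ≠ c → ¬ BallIso (G n) v r c'.tree c'.root :=
        fun c' _ hne h' => hne (TreeClass.eq_of_rootedIso h' hc)
      rw [Finset.sum_eq_single_of_mem c hcs fun c' h1 h2 => by rw [if_neg (hne c' h1 h2), mul_zero],
        Finset.sum_eq_single_of_mem c hcs fun c' h1 h2 => by rw [if_neg (hne c' h1 h2)],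
        if_pos hc, graphMsg_of_ballIso hc]
      simp
    · push Not at hex
      rw [Finset.sum_eq_zero fun c hc => by rw [if_neg (hex c hc), mul_zero],
        Finset.sum_eq_zero fun c hc => by rw [if_neg (hex c hc)], sub_zero, sub_zero, mul_one,
        abs_of_nonneg (graphMsg_nonneg hx r _ v)]
      exact graphMsg_le hx r _ v
  have e1 : (∑ v : V n, graphMsg x (G n) r Set.univ v) / (Fintype.card (V n) : ℝ)
      - ∑ c ∈ s, graphMsg x c.tree r Set.univ c.root *
        ((∑ v : V n, if BallIso (G n) v r c.tree c.root then (1 : ℝ) else 0) / Fintype.card (V n))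
      = (∑ v : V n, (graphMsg x (G n) r Set.univ v - ∑ c ∈ s, graphMsg x c.tree r Set.univ c.root *
        (if BallIso (G n) v r c.tree c.root then (1 : ℝ) else 0))) / Fintype.card (V n) := by
    rw [Finset.sum_sub_distrib, sub_div, Finset.sum_comm, Finset.sum_div]
    congr 1
    rw [Finset.sum_div]
    refine Finset.sum_congr rfl fun c _ => ?_
    rw [mul_div_assoc', Finset.mul_sum]
  have e2 : x⁻¹ * (1 - ∑ c ∈ s,
      (∑ v : V n, if BallIso (G n) v r c.tree c.root then (1 : ℝ) else 0) / Fintype.card (V n))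
      = (∑ v : V n, x⁻¹ * (1 - ∑ c ∈ s, if BallIso (G n) v r c.tree c.root then (1 : ℝ) else 0))
        / Fintype.card (V n) := by
    rw [← Finset.mul_sum, Finset.sum_sub_distrib, Finset.sum_comm, mul_div_assoc, sub_div,
      ← Finset.sum_div]
    simp [hN.ne']
  rw [e1, e2, abs_div, abs_of_pos hN]
  exact div_le_div_of_nonneg_right ((Finset.abs_sum_le_sum_abs _ _).trans
    (Finset.sum_le_sum fun v _ => hv v)) hN.le

/-! ### Convergence of the pressure -/

lemma tendsto_integral_treeMsg (P : PMF ℕ) {ρ : PMF ℕ} (hρ : mean ρ ≠ ∞) {x : ℝ} (hx : 0 < x) :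
    Tendsto (fun r => ∫ K, treeMsg x r K ∂offspringLaw P ρ) atTop
      (𝓝 (∫ p, rootMsg x p ∂rootLaw P (offspringLaw ρ ρ))) := by
  have e : ∫ p, rootMsg x p ∂rootLaw P (offspringLaw ρ ρ)
      = ∫ K, rootMsg x (K [], fun i => shift i K) ∂offspringLaw P ρ := by
    rw [← offspringLaw_map]
    exact integral_map measurable_root_shift.aemeasurable (measurable_rootMsg x).aestronglyMeasurable
  rw [e]
  refine tendsto_integral_of_dominated_convergence (fun _ => x⁻¹)
    (fun r => (measurable_treeMsg x r).aestronglyMeasurable) (integrable_const _)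
    (fun r => Eventually.of_forall fun K => ?_) ?_
  · rw [Real.norm_eq_abs, abs_of_nonneg (treeMsg_nonneg hx r K)]
    exact treeMsg_le hx r K
  · filter_upwards [ae_offspringLaw_shift (P := P) (ae_settles hρ)] with K hK
    exact tendsto_treeMsg_of_settles_shift hK hx

section Deterministic

variable {V : ℕ → Type*} [∀ n, Fintype (V n)] {G : ∀ n, SimpleGraph (V n)} {P ρ : PMF ℕ}

open Classical in
/-- Local convergence of a deterministic sequence of graphs to a Galton-Watson tree. -/
def ConvergesTo (G : ∀ n, SimpleGraph (V n)) (P ρ : PMF ℕ) : Prop :=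
  ∀ (r : ℕ) (c : TreeClass r), Tendsto
    (fun n => (∑ v : V n, if BallIso (G n) v r c.tree c.root then (1 : ℝ) else 0)
      / (Fintype.card (V n) : ℝ)) atTop (𝓝 (gwProb P ρ r c.tree c.root))

lemma ConvergesTo.eventually_card_pos (h : ConvergesTo G P ρ) :
    ∀ᶠ n in atTop, 0 < Fintype.card (V n) := by
  obtain ⟨c, hc⟩ : ∃ c : TreeClass 0, gwProb P ρ 0 c.tree c.root ≠ 0 := by
    by_contra! hall
    have h0 := hasSum_gwProb P ρ 0
    simp_rw [hall] at h0
    exact one_ne_zero (h0.unique hasSum_zero)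
  filter_upwards [(h 0 c).eventually_ne hc] with n hn
  refine Nat.pos_of_ne_zero fun h0 => hn ?_
  simp [h0]

lemma ConvergesTo.tendsto_average_msgIn (h : ConvergesTo G P ρ) (hρ : mean ρ ≠ ∞) {x : ℝ}
    (hx : 0 < x) :
    Tendsto (fun n => (∑ v : V n, msgIn (G n) x Finset.univ v) / (Fintype.card (V n) : ℝ)) atTop
      (𝓝 (∫ p, rootMsg x p ∂rootLaw P (offspringLaw ρ ρ))) := by
  have hr : ∀ r, Tendsto (fun n => (∑ v : V n, graphMsg x (G n) r Set.univ v)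
      / (Fintype.card (V n) : ℝ)) atTop (𝓝 (∫ K, treeMsg x r K ∂offspringLaw P ρ)) := fun r =>
    tendsto_average_graphMsg (h r) h.eventually_card_pos hx
  have hlim := tendsto_integral_treeMsg P hρ hx
  have heven : Tendsto (fun k : ℕ => 2 * k) atTop atTop := tendsto_id.const_mul_atTop' two_pos
  have hb : ∀ k n, (∑ v : V n, graphMsg x (G n) (2 * k) Set.univ v) / (Fintype.card (V n) : ℝ)
        ≤ (∑ v : V n, msgIn (G n) x Finset.univ v) / (Fintype.card (V n) : ℝ) ∧
      (∑ v : V n, msgIn (G n) x Finset.univ v) / (Fintype.card (V n) : ℝ)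
        ≤ (∑ v : V n, graphMsg x (G n) (2 * k + 1) Set.univ v) / (Fintype.card (V n) : ℝ) := by
    intro k n
    have hv := fun v : V n => graphMsg_le_msgIn_le (G := G n) hx k (Finset.mem_univ v)
    simp only [Finset.coe_univ] at hv
    exact ⟨div_le_div_of_nonneg_right (Finset.sum_le_sum fun v _ => (hv v).1) (Nat.cast_nonneg _),
      div_le_div_of_nonneg_right (Finset.sum_le_sum fun v _ => (hv v).2) (Nat.cast_nonneg _)⟩
  refine tendsto_order.2 ⟨fun a ha => ?_, fun a ha => ?_⟩
  · obtain ⟨k, hk⟩ := ((tendsto_order.1 (hlim.comp heven)).1 a ha).exists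
    filter_upwards [(tendsto_order.1 (hr (2 * k))).1 a hk] with n hn
    exact hn.trans_le (hb k n).1
  · obtain ⟨k, hk⟩ := ((tendsto_order.1
      (hlim.comp ((tendsto_add_atTop_nat 1).comp heven))).2 a ha).exists
    filter_upwards [(tendsto_order.1 (hr (2 * k + 1))).2 a hk] with n hn
    exact (hb k n).2.trans_lt hn

lemma measurable_msgIn {W : Type*} [Fintype W] (H : SimpleGraph W) (S : Finset W) (v : W) :
    Measurable fun t => msgIn H t S v := by
  have hZ : ∀ S : Finset W, Measurable (partitionIn H S) := fun S => by
    unfold partitionIn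
    fun_prop
  exact (hZ _).div (hZ _)

lemma average_msgIn_bounds {W : Type*} [Fintype W] (H : SimpleGraph W) {t : ℝ} (ht : 0 < t) :
    0 ≤ (∑ v : W, msgIn H t Finset.univ v) / (Fintype.card W : ℝ) ∧
      (∑ v : W, msgIn H t Finset.univ v) / (Fintype.card W : ℝ) ≤ t⁻¹ := by
  refine ⟨div_nonneg (Finset.sum_nonneg fun v _ => msgIn_nonneg ht _ v) (Nat.cast_nonneg _), ?_⟩
  refine div_le_of_le_mul₀ (Nat.cast_nonneg _) (inv_pos.2 ht).le ?_
  refine (Finset.sum_le_sum fun v hv => msgIn_le ht hv).trans ?_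
  simp [mul_comm]

lemma integral_average_msgIn {W : Type*} [Fintype W] (H : SimpleGraph W) {x y : ℝ} (hx : 0 < x)
    (hxy : x ≤ y) :
    ∫ t in x..y, (∑ v : W, msgIn H t Finset.univ v) / (Fintype.card W : ℝ)
      = Real.log (partitionFunction H y) / (Fintype.card W : ℝ)
        - Real.log (partitionFunction H x) / (Fintype.card W : ℝ) := by
  simp_rw [← partitionIn_univ]
  refine intervalIntegral.integral_eq_sub_of_hasDerivAt (f := fun t =>
    Real.log (partitionIn H Finset.univ t) / (Fintype.card W : ℝ)) (fun t ht => ?_) ?_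
  · rw [Set.uIcc_of_le hxy] at ht
    exact (hasDerivAt_log_partitionIn (hx.trans_le ht.1) Finset.univ).div_const _
  · rw [intervalIntegrable_iff_integrableOn_Ioc_of_le hxy]
    refine IntegrableOn.of_bound measure_Ioc_lt_top
      ((Finset.measurable_sum _ fun v _ =>
        measurable_msgIn H _ v).div_const _).aestronglyMeasurable x⁻¹ ?_
    refine (ae_restrict_iff' measurableSet_Ioc).2 (Eventually.of_forall fun t ht => ?_)
    have hb := average_msgIn_bounds H (hx.trans ht.1)
    rw [Real.norm_eq_abs, abs_of_nonneg hb.1]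
    exact hb.2.trans (inv_anti₀ hx ht.1.le)

lemma ConvergesTo.tendsto_increment (h : ConvergesTo G P ρ) (hPρ : IsUnimodular P ρ)
    (hP : secondMoment P ≠ ∞) (hρ : mean ρ ≠ ∞) {x y : ℝ} (hx : 0 < x) (hxy : x ≤ y) :
    Tendsto (fun n => Real.log (partitionFunction (G n) y) / (Fintype.card (V n) : ℝ)
        - Real.log (partitionFunction (G n) x) / (Fintype.card (V n) : ℝ)) atTop
      (𝓝 (pressure P ρ y - pressure P ρ x)) := by
  set a : ℕ → ℝ → ℝ := fun n t =>
    (∑ v : V n, msgIn (G n) t Finset.univ v) / (Fintype.card (V n) : ℝ) with ha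
  set m : ℝ → ℝ := fun t => ∫ p, rootMsg t p ∂rootLaw P (offspringLaw ρ ρ) with hm
  have ham : ∀ n, Measurable (a n) := fun n =>
    (Finset.measurable_sum _ fun v _ => measurable_msgIn (G n) _ v).div_const _
  have hlim : ∀ t, 0 < t → Tendsto (fun n => a n t) atTop (𝓝 (m t)) := fun t ht =>
    h.tendsto_average_msgIn hρ ht
  have hab : ∀ n, ∀ t ∈ Set.Ioc x y, ‖a n t‖ ≤ x⁻¹ := fun n t ht => by
    have hb := average_msgIn_bounds (G n) (hx.trans ht.1)
    rw [Real.norm_eq_abs, abs_of_nonneg hb.1]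
    exact hb.2.trans (inv_anti₀ hx ht.1.le)
  have hmi : IntervalIntegrable m volume x y := by
    rw [intervalIntegrable_iff_integrableOn_Ioc_of_le hxy]
    have hae : ∀ᵐ t ∂volume.restrict (Set.Ioc x y), Tendsto (fun n => a n t) atTop (𝓝 (m t)) :=
      (ae_restrict_iff' measurableSet_Ioc).2
        (Eventually.of_forall fun t ht => hlim t (hx.trans ht.1))
    refine IntegrableOn.of_bound measure_Ioc_lt_top
      (aestronglyMeasurable_of_tendsto_ae atTop (fun n => (ham n).aestronglyMeasurable) hae) x⁻¹ ?_
    refine (ae_restrict_iff' measurableSet_Ioc).2 (Eventually.of_forall fun t ht => ?_)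
    exact le_of_tendsto (hlim t (hx.trans ht.1)).norm (Eventually.of_forall fun n => hab n t ht)
  have hpm : ∫ t in x..y, m t = pressure P ρ y - pressure P ρ x :=
    intervalIntegral.integral_eq_sub_of_hasDerivAt (fun t ht => by
      rw [Set.uIcc_of_le hxy] at ht
      exact hasDerivAt_pressure hPρ hP hρ (hx.trans_le ht.1)) hmi
  rw [← hpm]
  simp_rw [← fun n => integral_average_msgIn (G n) hx hxy]
  refine intervalIntegral.tendsto_integral_filter_of_dominated_convergence (fun _ => x⁻¹)
    (Eventually.of_forall fun n => (ham n).aestronglyMeasurable)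
    (Eventually.of_forall fun n => Eventually.of_forall fun t ht => ?_) (by simp)
    (Eventually.of_forall fun t ht => ?_)
  · rw [Set.uIoc_of_le hxy] at ht
    exact hab n t ht
  · rw [Set.uIoc_of_le hxy] at ht
    exact hlim t (hx.trans ht.1)

open Classical in
/-- Convergence of the pressure for a deterministic sequence of graphs of bounded average
degree. -/
theorem ConvergesTo.tendsto_pressure (h : ConvergesTo G P ρ) (hPρ : IsUnimodular P ρ)
    (hP : secondMoment P ≠ ∞) (hρ : mean ρ ≠ ∞) {C : ℝ}
    (hC : ∀ᶠ n in atTop, ∑ v : V n, ((G n).degree v : ℝ) ≤ C * Fintype.card (V n)) {x : ℝ}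
    (hx : 0 < x) :
    Tendsto (fun n => Real.log (partitionFunction (G n) x) / (Fintype.card (V n) : ℝ)) atTop
      (𝓝 (pressure P ρ x)) := by
  have hP1 := mean_ne_top_of_secondMoment hP
  rw [Metric.tendsto_nhds]
  intro ε hε
  have hinv : Tendsto (fun y : ℝ => (|C| + 2 * (mean P).toReal) * (y ^ 2)⁻¹) atTop (𝓝 0) := by
    have h1 : Tendsto (fun y : ℝ => (y ^ 2)⁻¹) atTop (𝓝 0) :=
      tendsto_inv_atTop_zero.comp (tendsto_pow_atTop two_ne_zero)
    simpa using h1.const_mul (|C| + 2 * (mean P).toReal)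
  obtain ⟨y, hy, hxy⟩ := (((tendsto_order.1 hinv).2 (ε / 2) (half_pos hε)).and
    (eventually_ge_atTop x)).exists
  have hy0 : 0 < y := hx.trans_le hxy
  have hinc := Metric.tendsto_nhds.1 (h.tendsto_increment hPρ hP hρ hx hxy) (ε / 2) (half_pos hε)
  filter_upwards [hinc, hC, h.eventually_card_pos] with n h1 h2 h3
  have hN : (0 : ℝ) < Fintype.card (V n) := Nat.cast_pos.2 h3
  have h4 := abs_pressure_sub_log_le ρ hP1 hy0
  have h5 := log_partitionIn_bounds (G := G n) hy0 Finset.univ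
  rw [partitionIn_univ, Finset.card_univ, ← Finset.sum_mul] at h5
  have h6 : |Real.log (partitionFunction (G n) y) / (Fintype.card (V n) : ℝ) - Real.log y|
      ≤ |C| * (y ^ 2)⁻¹ := by
    have e : Real.log (partitionFunction (G n) y) / (Fintype.card (V n) : ℝ) - Real.log y
        = (Real.log (partitionFunction (G n) y) - Fintype.card (V n) * Real.log y)
          / (Fintype.card (V n) : ℝ) := by field_simp
    rw [e, abs_of_nonneg (div_nonneg (by linarith [h5.1]) hN.le), div_le_iff₀ hN]
    have h7 : (∑ v : V n, ((G n).degree v : ℝ)) * (y ^ 2)⁻¹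
        ≤ |C| * Fintype.card (V n) * (y ^ 2)⁻¹ :=
      mul_le_mul_of_nonneg_right (h2.trans (mul_le_mul_of_nonneg_right (le_abs_self C) hN.le))
        (by positivity)
    linarith [h5.2]
  rw [Real.dist_eq] at h1 ⊢
  rw [abs_lt] at h1 ⊢
  rw [abs_le] at h4 h6
  constructor <;> linarith [h1.1, h1.2, h4.1, h4.2, h6.1, h6.2]

open Classical in
lemma eventually_sum_degree_le
    (h : Tendsto (fun l : ℕ => limsup (fun n => highDegreeMass (G n) l) atTop) atTop (𝓝 0))
    (hcard : ∀ᶠ n in atTop, 0 < Fintype.card (V n)) :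
    ∃ C : ℝ, ∀ᶠ n in atTop, ∑ v : V n, ((G n).degree v : ℝ) ≤ C * Fintype.card (V n) := by
  obtain ⟨l, hl⟩ := ((tendsto_order.1 h).2 1 one_pos).exists
  refine ⟨l + 1, ?_⟩
  filter_upwards [eventually_lt_of_limsup_lt hl, hcard] with n hn hc
  have h1 : (∑ v : V n, if l ≤ (G n).degree v then (G n).degree v else 0) < Fintype.card (V n) := by
    have h0 : (Fintype.card (V n) : ℝ≥0∞) ≠ 0 := Nat.cast_ne_zero.2 hc.ne'
    rw [highDegreeMass, ENNReal.div_lt_iff (Or.inl h0) (Or.inl (ENNReal.natCast_ne_top _)),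
      one_mul] at hn
    exact_mod_cast hn
  have h2 : ∑ v : V n, (G n).degree v ≤ ∑ v : V n, (l + if l ≤ (G n).degree v then (G n).degree v
      else 0) := Finset.sum_le_sum fun v _ => by split_ifs <;> omega
  rw [Finset.sum_add_distrib, Finset.sum_const, Finset.card_univ, smul_eq_mul] at h2
  have h3 : ∑ v : V n, (G n).degree v ≤ (l + 1) * Fintype.card (V n) := by linarith
  exact_mod_cast h3

end Deterministic

end MonomerDimer

end

theorem mainTheorem2 {Ω : Type*} [MeasurableSpace Ω] (ℙ : Measure Ω) [IsProbabilityMeasure ℙ]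
    {V : ℕ → Ω → Type*} [∀ n ω, Fintype (V n ω)] (G : ∀ n ω, SimpleGraph (V n ω))
    (P ρ : PMF ℕ)
    (hPρ : MonomerDimer.IsUnimodular P ρ)
    (hG : MonomerDimer.LocallyConverges ℙ G P ρ)
    (hP : MonomerDimer.secondMoment P ≠ ∞) (hρ : MonomerDimer.mean ρ ≠ ∞)
    (hsparse : MonomerDimer.UniformlySparse ℙ G) :
    (∀ x : ℝ, 0 < x → ∃! ν : ProbabilityMeasure ℝ, MonomerDimer.IsFixedPoint ρ x ν) ∧
    (∀ x : ℝ, 0 < x → ∀ ν : ProbabilityMeasure ℝ, MonomerDimer.IsFixedPoint ρ x ν →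
      Integrable (MonomerDimer.vertexTerm x) (MonomerDimer.jointLaw P ν) ∧
      Integrable (MonomerDimer.edgeTerm x) (MonomerDimer.jointLaw P ν)) ∧
    (∀ᵐ ω ∂ℙ, ∀ x : ℝ, 0 < x →
      ∀ ν : ProbabilityMeasure ℝ, MonomerDimer.IsFixedPoint ρ x ν →
        Tendsto
          (fun n => Real.log (MonomerDimer.partitionFunction (G n ω) x)
            / (Fintype.card (V n ω) : ℝ))
          atTop (𝓝 (MonomerDimer.limitPressure P ν x))) := by
  refine ⟨fun x hx => MonomerDimer.existsUnique_isFixedPoint hρ hx, fun x hx ν hν => ?_, ?_⟩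
  · rw [hν.eq_limitLaw hρ hx]
    exact ⟨MonomerDimer.integrable_vertexTerm hPρ.1 hx, MonomerDimer.integrable_edgeTerm hx⟩
  · have hloc : ∀ᵐ ω ∂ℙ, MonomerDimer.ConvergesTo (fun n => G n ω) P ρ :=
      ae_all_iff.2 fun r => ae_all_iff.2 fun c => hG r c.size c.tree c.root c.2.1 c.2.2
    filter_upwards [hloc, hsparse] with ω hω hs x hx ν hν
    obtain ⟨C, hC⟩ := MonomerDimer.eventually_sum_degree_le hs hω.eventually_card_pos
    rw [hν.eq_limitLaw hρ hx, MonomerDimer.limitPressure_limitLaw hx]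
    exact hω.tendsto_pressure hPρ hP hρ hC hx
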